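/- Let $2 \le k \le m$ be integers. Let $\mathcal B_{m,k}$ be the associative unital $\mathbb C$-algebra with generators $x_1,\dots,x_m$ and defining relations $$\sum_{\sigma\in S_k} \operatorname{sgn}(\sigma)\, x_{i_{\sigma(1)}}\cdots x_{i_{\sigma(k)}} = 0 \qquad\text{for all } 1\le i_1<\dots<i_k\le m .$$ Call a finite sequence $\mathbf i=(i_1,\dots,i_\ell)$, $\ell\ge 0$, with entries in $\{1,\dots,m\}$ admissible if no $k$ consecutive entries of it are strictly decreasing, and let $\Lambda(m,k)$ be the set of admissible sequences. The admissible monomials $M_{\mathbf i}(X)=x_{i_1}\cdots x_{i_\ell}$, $\mathbf i\in\Lambda(m,k)$, form a linear basis of $\mathcal B_{m,k}$. Let $A=(a_{ij})$ be a complex $m\times m$ matrix, put $y_i=a_{i1}x_1+\dots+a_{im}x_m$ and $M_{\mathbf i}(AX)=y_{i_1}\cdots y_{i_\ell}\in\mathcal B_{m,k}$, and for $\mathbf i\in\Lambda(m,k)$ let $G(\mathbf i)$ be the coefficient of $M_{\mathbf i}(X)$ in the expansion of $M_{\mathbf i}(AX)$ in this basis. Let $t_1,\dots,t_m$ be commuting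 variables, $T=\operatorname{diag}(t_1,\dots,t_m)$, and define $c_r(TA)\in\mathbb C[t_1,\dots,t_m]$ by $\det(\lambda I-TA)=\sum_{r=0}^m c_r(TA)\,\lambda^{m-r}$. Then, as formal power series in $t_1,\dots,t_m$, $$\Bigl(\sum_{(i_1,\dots,i_\ell)\in\Lambda(m,k)} G(i_1,\dots,i_\ell)\,t_{i_1}\cdots t_{i_\ell}\Bigr)\cdot\Bigl(\sum_{\substack{0\le r\le m\\ r\equiv 0,1 \bmod k}} (-1)^{r-(r\bmod k)}\,c_r(TA)\Bigr)=1 .$$ For $k=2$ this is the MacMahon Master Theorem: the second factor is then $\det(I-TA)$, and the first factor is $\sum_{(d_1,\dots,d_m)} G(d_1,\dots,d_m)\,t_1^{d_1}\cdots t_m^{d_m}$, where the sum is over all vectors of nonnegative integers and $G(d_1,\dots,d_m)$ is the coefficient of $x_1^{d_1}\cdots x_m^{d_m}$ in the product $\prod_{i=1}^m (a_{i1}x_1+\dots+a_{im}x_m)^{d_i}$ of polynomials in commuting variables. -/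

import Mathlib

noncomputable section

namespace MasterKoszul

/-- The defining relations: for all `i₁ < ⋯ < i_k`, the antisymmetrization
`∑_{σ ∈ S_k} sign(σ) x_{i_{σ(1)}} ⋯ x_{i_{σ(k)}}` is set equal to zero. -/
inductive AntisymRel (m k : ℕ) : FreeAlgebra ℂ (Fin m) → FreeAlgebra ℂ (Fin m) → Prop
  | antisym (i : Fin k → Fin m) (hi : StrictMono i) :
      AntisymRel m k
        (∑ σ : Equiv.Perm (Fin k), ((Equiv.Perm.sign σ : ℤ) : ℂ) •
          (List.ofFn fun s : Fin k => FreeAlgebra.ι ℂ (i (σ s))).prod) 0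

/-- The algebra `B_{m,k}`: generators `x_1, …, x_m` and the degree-`k`
antisymmetrization relations. -/
abbrev AntisymAlgebra (m k : ℕ) : Type := RingQuot (AntisymRel m k)

/-- The generator `x_j` of `B_{m,k}`. -/
def gen (m k : ℕ) (j : Fin m) : AntisymAlgebra m k :=
  RingQuot.mkAlgHom ℂ (AntisymRel m k) (FreeAlgebra.ι ℂ j)

/-- A finite sequence is admissible if no `k` consecutive entries are strictly decreasing. -/
def IsAdmissible {m : ℕ} (k : ℕ) (i : List (Fin m)) : Prop :=
  ∀ s : List (Fin m), s <:+: i → s.length = k → ¬ s.Pairwise (· > ·)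

/-- The set `Λ(m,k)` of admissible sequences, of all lengths (the empty one included). -/
abbrev AdmissibleSeq (m k : ℕ) : Type := {i : List (Fin m) // IsAdmissible k i}

/-- `M_i(X) = x_{i_1} ⋯ x_{i_ℓ}` in `B_{m,k}`. -/
def monomialX {m k : ℕ} (i : List (Fin m)) : AntisymAlgebra m k :=
  (i.map (gen m k)).prod

/-- `M_i(AX) = y_{i_1} ⋯ y_{i_ℓ}` in `B_{m,k}`, with `y_i = a_{i1} x_1 + ⋯ + a_{im} x_m`. -/
def monomialAX {m k : ℕ} (A : Matrix (Fin m) (Fin m) ℂ) (i : List (Fin m)) :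
    AntisymAlgebra m k :=
  (i.map fun s => ∑ j, A s j • gen m k j).prod

/-- `G(i)`: the coefficient of the basis vector with index `i` in `M_i(AX)`. It is used for the
basis `b` of admissible monomials. -/
def coeffG {m k : ℕ} (b : Module.Basis (AdmissibleSeq m k) ℂ (AntisymAlgebra m k))
    (A : Matrix (Fin m) (Fin m) ℂ) (i : AdmissibleSeq m k) : ℂ :=
  b.repr (monomialAX A i.1) i

open Classical in
/-- The formal power series `∑_{i ∈ Λ(m,k)} G(i) t_{i_1} ⋯ t_{i_ℓ}`: the coefficient of `t^d` is
the finite sum of the `G(i)` over the admissible `i` in which each `j` occurs `d j` times. -/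
def masterSeries {m k : ℕ} (b : Module.Basis (AdmissibleSeq m k) ℂ (AntisymAlgebra m k))
    (A : Matrix (Fin m) (Fin m) ℂ) : MvPowerSeries (Fin m) ℂ :=
  fun d => ∑ i ∈ (Multiset.lists (Finsupp.toMultiset d)).toFinset.subtype (IsAdmissible k),
    coeffG b A i

/-- The matrix `TA` over `ℂ[t_1, …, t_m]`, where `T = diag(t_1, …, t_m)`. -/
def matrixTA {m : ℕ} (A : Matrix (Fin m) (Fin m) ℂ) :
    Matrix (Fin m) (Fin m) (MvPolynomial (Fin m) ℂ) :=
  Matrix.diagonal (fun i => MvPolynomial.X i) * A.map MvPolynomial.C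

/-- `c_r(TA)`, the coefficient of `λ^{m-r}` in `det(λ I - TA)` (for `r ≤ m`). -/
def charCoeff {m : ℕ} (A : Matrix (Fin m) (Fin m) ℂ) (r : ℕ) : MvPolynomial (Fin m) ℂ :=
  (matrixTA A).charpoly.coeff (m - r)

/-- `∑ (-1)^{r - (r mod k)} c_r(TA)`, over the `0 ≤ r ≤ m` with `r ≡ 0, 1 mod k`. -/
def signedCharSum {m : ℕ} (k : ℕ) (A : Matrix (Fin m) (Fin m) ℂ) : MvPolynomial (Fin m) ℂ :=
  ∑ r ∈ (Finset.range (m + 1)).filter (fun r => r ≡ 0 [MOD k] ∨ r ≡ 1 [MOD k]),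
    (-1) ^ (r - r % k) * charCoeff A r

/-- The series of the classical MacMahon Master Theorem: the coefficient of
`t_1^{d_1} ⋯ t_m^{d_m}` is the coefficient of `x_1^{d_1} ⋯ x_m^{d_m}` in the product
`∏_i (a_{i1} x_1 + ⋯ + a_{im} x_m)^{d_i}` of commutative polynomials. -/
def macMahonSeries {m : ℕ} (A : Matrix (Fin m) (Fin m) ℂ) : MvPowerSeries (Fin m) ℂ :=
  fun d => MvPolynomial.coeff d
    (∏ i, (∑ j, MvPolynomial.C (A i j) * MvPolynomial.X j : MvPolynomial (Fin m) ℂ) ^ d i)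

end MasterKoszul

end

/-!
The algebra `B = B_{m,k}` is graded, and a linear substitution `x_i ↦ ∑ a_{ij} x_j` extends to an
endomorphism of it (`substHom`), because the antisymmetrized product of `k` arbitrary linear forms
vanishes in `B` (`antisymProd_eq_zero`). The component of degree `n` of the master series is the
trace of the substitution `x_i ↦ t_i y_i` on `B_n` (`eval_tracePoly`), so the assertion is an
identity between traces on `B` and the sums of principal minors of `TA`
(`sum_antidiagonal_trace`). Both sides are invariant under conjugation. Hence the matrix may be
taken triangular (`exists_triangular_conj`), and then only its diagonal matters
(`trace_substMatrix_of_triangular`): a word obtained by lowering letters can only contribute to the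
diagonal if it has the same letters as, hence is equal to, the original word. For a diagonal matrix
the identity is a statement about words: in the factorizations of a nonempty word into a strictly decreasing and
an admissible word, the signs cancel (`sum_koszulSign_factorizations`), as the admissible lengths of
the decreasing factor form a window of `k` consecutive integers, or an initial
segment containing `0` and `1`.

The basis theorem rests on a triangular family of tensors. To a word `w` with maximal strictly
decreasing runs `D₁, …, D_r` associate the tensor product `runTensor w` of the antisymmetrizations
of the `D_j`. Its lexicographically largest word is `w`, and it is alternating on every window of
positions on which `w` decreases. Comparing largest words, the tensors that are alternating on a
given window are spanned by the `runTensor w` of the words `w` which decrease there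
(`IsAltOn.mem_span`). So the relations of `B` in degree `n` lie in the span of the `runTensor w` with
`w` inadmissible, and by triangularity no nonzero combination of admissible words is in this
span. Conversely, a decreasing window can be rewritten by lexicographically smaller words
(`monomialX_mem_span`).

For `k = 2` there is exactly one admissible word for each content, and `G` is read off after mapping
`B_{m,2}` to the polynomial ring (`toPolynomial`).
-/

namespace MasterKoszul

open Finset

/-! ### Alternating tensors and decreasing runs -/

section Alternating

variable {ι α : Type*} [LinearOrder ι] [LinearOrder α]

/-- The positions `i` and `j` lie in one strictly decreasing run of the word `w`. -/
def SameRun (w : ι → α) (i j : ι) : Prop := StrictAntiOn w (Set.uIcc i j)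

lemma SameRun.refl (w : ι → α) (i : ι) : SameRun w i i := by
  simp [SameRun]

lemma SameRun.symm {w : ι → α} {i j : ι} (h : SameRun w i j) : SameRun w j i := by
  rwa [SameRun, Set.uIcc_comm]

lemma SameRun.trans {w : ι → α} {i j l : ι} (hij : SameRun w i j) (hjl : SameRun w j l) :
    SameRun w i l := by
  have key : StrictAntiOn w (Set.uIcc i j ∪ Set.uIcc j l) := by
    unfold SameRun at hij hjl
    rcases le_total i j with h1 | h1 <;> rcases le_total j l with h2 | h2
    · rw [Set.uIcc_of_le h1] at *; rw [Set.uIcc_of_le h2] at *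
      exact hij.union hjl (isGreatest_Icc h1) (isLeast_Icc h2)
    · rw [Set.uIcc_of_le h1] at *; rw [Set.uIcc_of_ge h2] at *
      rcases le_total i l with h3 | h3
      · rwa [Set.union_eq_left.2 (Set.Icc_subset_Icc_left h3)]
      · rwa [Set.union_eq_right.2 (Set.Icc_subset_Icc_left h3)]
    · rw [Set.uIcc_of_ge h1] at *; rw [Set.uIcc_of_le h2] at *
      rcases le_total i l with h3 | h3
      · rwa [Set.union_eq_right.2 (Set.Icc_subset_Icc_right h3)]
      · rwa [Set.union_eq_left.2 (Set.Icc_subset_Icc_right h3)]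
    · rw [Set.uIcc_of_ge h1] at *; rw [Set.uIcc_of_ge h2] at *
      rw [Set.union_comm]
      exact hjl.union hij (isGreatest_Icc h2) (isLeast_Icc h1)
  exact key.mono Set.uIcc_subset_uIcc_union_uIcc

variable [Fintype ι]

open Classical in
/-- The permutations of the positions which preserve every decreasing run of `w`
(a Young subgroup). -/
noncomputable def runPerms (w : ι → α) : Finset (Equiv.Perm ι) :=
  univ.filter fun σ => ∀ i, SameRun w i (σ i)

lemma mem_runPerms {w : ι → α} {σ : Equiv.Perm ι} :
    σ ∈ runPerms w ↔ ∀ i, SameRun w i (σ i) := by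
  simp [runPerms]

lemma one_mem_runPerms (w : ι → α) : (1 : Equiv.Perm ι) ∈ runPerms w :=
  mem_runPerms.2 fun i => SameRun.refl w i

lemma mul_mem_runPerms {w : ι → α} {σ τ : Equiv.Perm ι} (hσ : σ ∈ runPerms w)
    (hτ : τ ∈ runPerms w) : σ * τ ∈ runPerms w :=
  mem_runPerms.2 fun i => (mem_runPerms.1 hτ i).trans (mem_runPerms.1 hσ (τ i))

lemma inv_mem_runPerms {w : ι → α} {σ : Equiv.Perm ι} (hσ : σ ∈ runPerms w) :
    σ⁻¹ ∈ runPerms w :=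
  mem_runPerms.2 fun i => by simpa using (mem_runPerms.1 hσ (σ⁻¹ i)).symm

/-- A nontrivial permutation inside the decreasing runs makes the word lexicographically
smaller: at the first position that moves, the letter is replaced by a later one of its run. -/
lemma toLex_comp_lt {w : ι → α} {σ : Equiv.Perm ι} (hσ : σ ∈ runPerms w) (h1 : σ ≠ 1) :
    toLex (w ∘ σ) < toLex w := by
  have hne : (univ.filter fun i => σ i ≠ i).Nonempty := by
    by_contra h
    refine h1 (Equiv.ext fun i => ?_)
    by_contra hi
    exact h ⟨i, by simpa using hi⟩
  obtain ⟨i, hi, hmin⟩ := (univ.filter fun i => σ i ≠ i).exists_min_image id hne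
  simp only [mem_filter, mem_univ, true_and, id] at hi hmin
  have hfix : ∀ j < i, σ j = j := fun j hj => by
    by_contra h
    exact absurd (hmin j h) (not_le.2 hj)
  have hlt : i < σ i := by
    refine lt_of_le_of_ne (not_lt.1 fun h => ?_) (Ne.symm hi)
    exact hi (σ.injective (hfix _ h))
  refine ⟨i, fun j hj => ?_, ?_⟩
  · simp [hfix j hj]
  · exact mem_runPerms.1 hσ i Set.left_mem_uIcc Set.right_mem_uIcc hlt

/-- The antisymmetrization of the word `w` within each of its maximal decreasing runs, as a tensor,
that is, as a function of words: for `w = D₁ ⋯ D_r` with decreasing runs `D_j`, it is the tensor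
product of the antisymmetrizations of the `D_j`. -/
noncomputable def runTensor (w : ι → α) : (ι → α) → ℂ :=
  ∑ σ ∈ runPerms w, ((Equiv.Perm.sign σ : ℤ) : ℂ) • Pi.single (w ∘ σ) (1 : ℂ)

/-- The tensor `f` is alternating in the positions of `S`: it changes sign under every transposition
of two of them. -/
def IsAltOn (S : Set ι) (f : (ι → α) → ℂ) : Prop :=
  ∀ i ∈ S, ∀ j ∈ S, i ≠ j → ∀ w, f (w ∘ Equiv.swap i j) = -f w

lemma runTensor_apply_of_lt {w u : ι → α} (h : toLex w < toLex u) : runTensor w u = 0 := by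
  rw [runTensor, Finset.sum_apply]
  refine Finset.sum_eq_zero fun σ hσ => ?_
  have : u ≠ w ∘ σ := by
    rintro rfl
    rcases eq_or_ne σ 1 with rfl | h1
    · exact lt_irrefl _ h
    · exact lt_asymm h (toLex_comp_lt hσ h1)
  simp [this]

lemma runTensor_apply_self (w : ι → α) : runTensor w w = 1 := by
  rw [runTensor, Finset.sum_apply, Finset.sum_eq_single_of_mem 1 (one_mem_runPerms w)]
  · simp
  · intro σ hσ h1
    have : w ≠ w ∘ σ := fun h => (toLex_comp_lt hσ h1).ne (congrArg toLex h.symm)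
    simp [this]

lemma IsAltOn.runTensor {S : Set ι} (hS : S.OrdConnected) {w : ι → α} (hw : StrictAntiOn w S) :
    IsAltOn S (runTensor w) := by
  intro p hp q hq hpq u
  set τ := Equiv.swap p q with hτ
  have hτw : τ ∈ runPerms w := mem_runPerms.2 fun i => by
    rcases eq_or_ne i p with rfl | hip
    · rw [hτ, Equiv.swap_apply_left]; exact hw.mono (hS.uIcc_subset hp hq)
    · rcases eq_or_ne i q with rfl | hiq
      · rw [hτ, Equiv.swap_apply_right]; exact hw.mono (hS.uIcc_subset hq hp)
      · rw [hτ, Equiv.swap_apply_of_ne_of_ne hip hiq]; exact SameRun.refl w i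
  have hsτ : Equiv.Perm.sign τ = -1 := Equiv.Perm.sign_swap hpq
  simp only [MasterKoszul.runTensor, Finset.sum_apply, ← Finset.sum_neg_distrib, Pi.smul_apply,
    smul_eq_mul]
  refine Finset.sum_bij' (fun σ _ => σ * τ⁻¹) (fun σ _ => σ * τ)
    (fun σ hσ => mul_mem_runPerms hσ (inv_mem_runPerms hτw))
    (fun σ hσ => mul_mem_runPerms hσ hτw) (fun σ _ => by simp) (fun σ _ => by simp) fun σ _ => ?_
  have h1 : u ∘ τ = w ∘ σ ↔ u = w ∘ ⇑(σ * τ⁻¹) := by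
    constructor
    · intro h
      have : u = (u ∘ τ) ∘ ⇑τ⁻¹ := by ext; simp
      rw [this, h]; rfl
    · rintro rfl
      ext; simp
  simp only [Pi.single_apply, h1, Equiv.Perm.sign_mul, Equiv.Perm.sign_inv, hsτ]
  simp

/-- The lexicographically largest word in the support of an alternating tensor decreases strictly
on the alternating positions: otherwise a transposition would yield a larger one. -/
lemma IsAltOn.strictAntiOn {S : Set ι} {f : (ι → α) → ℂ} (hf : IsAltOn S f) {w : ι → α}
    (hw : f w ≠ 0) (hmax : ∀ u, f u ≠ 0 → toLex u ≤ toLex w) : StrictAntiOn w S := by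
  intro i hi j hj hij
  by_contra hle
  rw [not_lt] at hle
  have hsw := hf i hi j hj hij.ne w
  rcases hle.eq_or_lt with h | h
  · have : w ∘ Equiv.swap i j = w := by
      ext l
      rcases eq_or_ne l i with rfl | hl
      · simp [h]
      · rcases eq_or_ne l j with rfl | hl'
        · simp [h]
        · simp [Equiv.swap_apply_of_ne_of_ne hl hl']
    rw [this] at hsw
    exact hw (self_eq_neg.1 hsw)
  · refine absurd (hmax (w ∘ Equiv.swap i j) (by rw [hsw]; exact neg_ne_zero.2 hw)) (not_le.2 ?_)
    refine ⟨i, fun l hl => ?_, ?_⟩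
    · simp [Equiv.swap_apply_of_ne_of_ne hl.ne (hl.trans hij).ne]
    · simpa using h

/-- Tensors alternating on an interval `S` of positions are spanned by the `runTensor w` of the
words `w` that decrease on `S`. The generators do not depend on `S`, so the `runTensor w` form
a basis that is adapted to all these subspaces at once. -/
lemma IsAltOn.mem_span [Fintype α] {S : Set ι} (hS : S.OrdConnected) {f : (ι → α) → ℂ}
    (hf : IsAltOn S f) :
    f ∈ Submodule.span ℂ (MasterKoszul.runTensor '' {w : ι → α | StrictAntiOn w S}) := by
  classical
  -- Subtracting a multiple of `runTensor w`, with `w` the largest word of the support, lowers the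
  -- bound `v` on the support; the bound `⊤` covers the general case.
  suffices H : ∀ v : WithTop (Lex (ι → α)), ∀ f : (ι → α) → ℂ, IsAltOn S f →
      (∀ u, f u ≠ 0 → ((toLex u : Lex (ι → α)) : WithTop (Lex (ι → α))) < v) →
      f ∈ Submodule.span ℂ (MasterKoszul.runTensor '' {w : ι → α | StrictAntiOn w S}) from
    H ⊤ f hf fun u _ => WithTop.coe_lt_top _
  intro v
  induction v using WellFoundedLT.induction with
  | ind v ih =>
    intro f hf hv
    by_cases h0 : (univ.filter fun u => f u ≠ 0).Nonempty
    · obtain ⟨w, hw, hmax⟩ := (univ.filter fun u => f u ≠ 0).exists_max_image toLex h0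
      simp only [mem_filter, mem_univ, true_and] at hw hmax
      have hanti := hf.strictAntiOn hw hmax
      have hmem : MasterKoszul.runTensor w ∈
          Submodule.span ℂ (MasterKoszul.runTensor '' {w : ι → α | StrictAntiOn w S}) :=
        Submodule.subset_span ⟨w, hanti, rfl⟩
      have := ih _ (hv w hw) (f - f w • MasterKoszul.runTensor w) ?_ ?_
      · simpa using Submodule.add_mem _ this (Submodule.smul_mem _ (f w) hmem)
      · intro p hp q hq hpq u
        simp only [Pi.sub_apply, Pi.smul_apply, smul_eq_mul, hf p hp q hq hpq u,
          IsAltOn.runTensor hS hanti p hp q hq hpq u]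
        ring
      · intro u hu
        rw [WithTop.coe_lt_coe]
        by_contra hle
        rw [not_lt] at hle
        rcases hle.eq_or_lt with h | h
        · obtain rfl : w = u := toLex.injective h
          simp [runTensor_apply_self] at hu
        · refine hu ?_
          have : f u = 0 := by
            by_contra h'
            exact absurd (hmax u h') (not_le.2 h)
          simp [this, runTensor_apply_of_lt h]
    · have : f = 0 := by
        ext u
        by_contra h
        exact h0 ⟨u, by simpa using h⟩
      rw [this]; exact zero_mem _

/-- The `runTensor w` are triangular, so a combination of them which vanishes at each of the words
involved is zero. -/
lemma eq_zero_of_mem_span_runTensor {W : Set (ι → α)} {f : (ι → α) → ℂ}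
    (hf : f ∈ Submodule.span ℂ (runTensor '' W)) (h0 : ∀ w ∈ W, f w = 0) : f = 0 := by
  classical
  obtain ⟨c, hc, rfl⟩ := (Finsupp.mem_span_image_iff_linearCombination ℂ).1 hf
  suffices c = 0 by simp [this]
  by_contra hne
  obtain ⟨w, hw, hmax⟩ := c.support.exists_max_image toLex (Finsupp.support_nonempty_iff.2 hne)
  have hwW : w ∈ W := hc hw
  have := h0 w hwW
  rw [Finsupp.linearCombination_apply, Finsupp.sum, Finset.sum_apply,
    Finset.sum_eq_single_of_mem w hw] at this
  · simp [runTensor_apply_self] at this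
    exact (Finsupp.mem_support_iff.1 hw) this
  · intro u hu huw
    have : toLex u < toLex w := lt_of_le_of_ne (hmax u hu) (fun h => huw (toLex.injective h))
    simp [runTensor_apply_of_lt this]

end Alternating

/-! ### The relations and linear substitutions -/

section Algebra

variable {m k : ℕ}

/-- The image in `B_{m,k}` of a vector, that is, of a linear combination of the variables. -/
noncomputable def linGen (m k : ℕ) : (Fin m → ℂ) →ₗ[ℂ] AntisymAlgebra m k :=
  Fintype.linearCombination ℂ (gen m k)

lemma linGen_apply (v : Fin m → ℂ) : linGen m k v = ∑ j, v j • gen m k j := by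
  simp [linGen, Fintype.linearCombination_apply]

/-- The antisymmetrized product `V^k → B_{m,k}`. -/
noncomputable def antisymProd (m k : ℕ) : (Fin m → ℂ) [⋀^Fin k]→ₗ[ℂ] AntisymAlgebra m k :=
  MultilinearMap.alternatization
    ((MultilinearMap.mkPiAlgebraFin ℂ k (AntisymAlgebra m k)).compLinearMap fun _ => linGen m k)

lemma antisymProd_apply (v : Fin k → Fin m → ℂ) :
    antisymProd m k v = ∑ σ : Equiv.Perm (Fin k), ((Equiv.Perm.sign σ : ℤ) : ℂ) •
      (List.ofFn fun s => linGen m k (v (σ s))).prod := by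
  rw [antisymProd, MultilinearMap.alternatization_apply]
  refine Finset.sum_congr rfl fun σ _ => ?_
  rw [Units.smul_def, ← Int.cast_smul_eq_zsmul ℂ]
  simp [MultilinearMap.compLinearMap_apply]

lemma antisymProd_single_of_strictMono {i : Fin k → Fin m} (hi : StrictMono i) :
    antisymProd m k (fun s => Pi.single (i s) 1) = 0 := by
  have h := RingQuot.mkAlgHom_rel ℂ (AntisymRel.antisym (m := m) (k := k) i hi)
  rw [map_zero, map_sum] at h
  rw [antisymProd_apply, ← h]
  refine Finset.sum_congr rfl fun σ _ => ?_
  rw [map_smul, map_list_prod, List.map_ofFn]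
  congr 3
  ext s
  simp [linGen_apply, Pi.single_apply, gen]

/-- The relations hold for arbitrary linear combinations of the generators, since the
antisymmetrized product is alternating and multilinear. -/
lemma antisymProd_eq_zero : antisymProd m k = 0 := by
  refine Module.Basis.ext_alternating (Pi.basisFun ℂ (Fin m)) fun v hv => ?_
  have hmono : StrictMono (v ∘ Tuple.sort v) :=
    (Tuple.monotone_sort v).strictMono_of_injective (hv.comp (Tuple.sort v).injective)
  have h := antisymProd_single_of_strictMono (k := k) hmono
  have h2 := (antisymProd m k).map_perm (fun s => Pi.single (v s) 1) (Tuple.sort v)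
  have h3 : (fun s => (Pi.single (v s) 1 : Fin m → ℂ)) ∘ ⇑(Tuple.sort v) =
    fun s => Pi.single ((v ∘ Tuple.sort v) s) 1 := rfl
  rw [h3, h] at h2
  simp only [Pi.basisFun_apply, AlternatingMap.zero_apply]
  exact ((smul_eq_zero_iff_eq _).1 h2.symm)

/-- The endomorphism of `B_{m,k}` given by the linear substitution `x_i ↦ y_i`. -/
noncomputable def substHom (k : ℕ) (A : Matrix (Fin m) (Fin m) ℂ) :
    AntisymAlgebra m k →ₐ[ℂ] AntisymAlgebra m k :=
  RingQuot.liftAlgHom ℂ ⟨FreeAlgebra.lift ℂ fun s => linGen m k (A s), by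
    rintro _ _ ⟨i, hi⟩
    rw [map_zero, map_sum]
    have h := antisymProd_apply (k := k) fun s => A (i s)
    rw [antisymProd_eq_zero, AlternatingMap.zero_apply] at h
    rw [h]
    refine Finset.sum_congr rfl fun σ _ => ?_
    rw [map_smul, map_list_prod, List.map_ofFn]
    congr 3
    ext s
    simp⟩

lemma substHom_gen (A : Matrix (Fin m) (Fin m) ℂ) (s : Fin m) :
    substHom k A (gen m k s) = linGen m k (A s) := by
  simp [substHom, gen]

lemma algHom_ext_gen {B : Type*} [Semiring B] [Algebra ℂ B] {f g : AntisymAlgebra m k →ₐ[ℂ] B}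
    (h : ∀ s, f (gen m k s) = g (gen m k s)) : f = g := by
  apply RingQuot.ringQuot_ext'
  apply FreeAlgebra.hom_ext
  ext s
  exact h s

lemma substHom_mul (A B : Matrix (Fin m) (Fin m) ℂ) :
    substHom k (A * B) = (substHom k B).comp (substHom k A) := by
  refine algHom_ext_gen fun s => ?_
  simp only [AlgHom.comp_apply, substHom_gen]
  rw [linGen_apply (A s), map_sum]
  simp only [map_smul, substHom_gen]
  simp only [← map_smul, ← map_sum]
  congr 1
  ext l
  simp [Matrix.mul_apply]

lemma substHom_monomialX (A : Matrix (Fin m) (Fin m) ℂ) (i : List (Fin m)) :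
    substHom k A (monomialX i) = monomialAX A i := by
  rw [monomialX, map_list_prod, List.map_map, monomialAX]
  congr 2
  ext s
  simp [substHom_gen, linGen_apply]

/-- Expansion of a product of linear forms as a sum over words. -/
lemma monomialAX_ofFn {n : ℕ} (A : Matrix (Fin m) (Fin m) ℂ) (i : Fin n → Fin m) :
    (monomialAX A (List.ofFn i) : AntisymAlgebra m k) =
      ∑ w : Fin n → Fin m, (∏ s, A (i s) (w s)) • monomialX (List.ofFn w) := by
  have h := MultilinearMap.map_sum (MultilinearMap.mkPiAlgebraFin ℂ n (AntisymAlgebra m k))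
    (fun s j => A (i s) j • gen m k j)
  simp only [MultilinearMap.map_smul_univ] at h
  simpa [monomialAX, monomialX, List.map_ofFn, Function.comp_def] using h

end Algebra

/-! ### Words with a distinguished window -/

section Frame

variable {α : Type*} {a k b : ℕ}

/-- The concatenation of three words given as functions. -/
def frame (u : Fin a → α) (c : Fin k → α) (v : Fin b → α) : Fin (a + k + b) → α :=
  Fin.append (Fin.append u c) v

/-- The positions of the middle word in a concatenation of three words. -/
def midPos (a k b : ℕ) (s : Fin k) : Fin (a + k + b) := Fin.castAdd b (Fin.natAdd a s)

lemma ofFn_frame (u : Fin a → α) (c : Fin k → α) (v : Fin b → α) :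
    List.ofFn (frame u c v) = List.ofFn u ++ List.ofFn c ++ List.ofFn v := by
  simp [frame, List.ofFn_fin_append]

lemma frame_midPos (u : Fin a → α) (c : Fin k → α) (v : Fin b → α) (s : Fin k) :
    frame u c v (midPos a k b s) = c s := by
  simp [frame, midPos]

lemma frame_surjective (w : Fin (a + k + b) → α) :
    ∃ u : Fin a → α, ∃ v : Fin b → α, w = frame u (w ∘ midPos a k b) v := by
  refine ⟨fun s => w (Fin.castAdd b (Fin.castAdd k s)), fun s => w (Fin.natAdd (a + k) s), ?_⟩
  ext x
  refine Fin.addCases (fun y => ?_) (fun y => ?_) x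
  · refine Fin.addCases (fun z => ?_) (fun z => ?_) y <;> simp [frame, midPos]
  · simp [frame]

lemma midPos_strictMono : StrictMono (midPos a k b) := fun s t h => by
  rw [Fin.lt_def] at h ⊢
  simpa [midPos] using h

lemma ordConnected_range_midPos : (Set.range (midPos a k b)).OrdConnected := by
  rw [Set.ordConnected_iff]
  rintro _ ⟨s, rfl⟩ _ ⟨t, rfl⟩ - x ⟨h1, h2⟩
  rw [Fin.le_def] at h1 h2
  simp only [midPos, Fin.val_castAdd, Fin.val_natAdd] at h1 h2
  exact ⟨⟨x - a, by omega⟩, by ext; simp [midPos]; omega⟩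

lemma frame_comp_swap (u : Fin a → α) (c : Fin k → α) (v : Fin b → α) (p q : Fin k) :
    frame u c v ∘ Equiv.swap (midPos a k b p) (midPos a k b q) =
      frame u (c ∘ Equiv.swap p q) v := by
  ext x
  by_cases hx : ∃ s, midPos a k b s = x
  · obtain ⟨s, rfl⟩ := hx
    rw [Function.comp_apply, midPos_strictMono.injective.swap_apply, frame_midPos, frame_midPos,
      Function.comp_apply]
  · rw [Function.comp_apply, Equiv.swap_apply_of_ne_of_ne (fun h => hx ⟨_, h.symm⟩)
      (fun h => hx ⟨_, h.symm⟩)]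
    revert hx
    refine Fin.addCases (fun y => ?_) (fun y => ?_) x
    · refine Fin.addCases (fun z => ?_) (fun z => ?_) y
      · simp [frame]
      · exact fun hx => absurd ⟨z, rfl⟩ hx
    · simp [frame]

lemma toLex_frame_lt [LinearOrder α] (u : Fin a → α) {c c' : Fin k → α} (v : Fin b → α)
    (h : toLex c < toLex c') : toLex (frame u c v) < toLex (frame u c' v) := by
  obtain ⟨i, hi, hlt⟩ := h
  refine ⟨midPos a k b i, fun x => ?_, ?_⟩
  · refine Fin.addCases (fun y => ?_) (fun y => ?_) x
    · refine Fin.addCases (fun z => ?_) (fun z => ?_) y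
      · simp [frame]
      · intro hz
        have := hi z (midPos_strictMono.lt_iff_lt.1 hz)
        simpa [frame] using this
    · simp [frame]
  · change frame u c v _ < frame u c' v _
    rw [frame_midPos, frame_midPos]
    exact hlt

lemma exists_ofFn_eq {n : ℕ} {l : List α} (h : l.length = n) :
    ∃ f : Fin n → α, List.ofFn f = l := by
  subst h
  exact ⟨l.get, List.ofFn_get l⟩

end Frame

/-! ### The basis of admissible monomials -/

section Basis

variable {m k : ℕ}

lemma not_isAdmissible_of_strictAntiOn {a b : ℕ} {w : Fin (a + k + b) → Fin m}
    (h : StrictAntiOn w (Set.range (midPos a k b))) : ¬ IsAdmissible k (List.ofFn w) := by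
  intro hadm
  obtain ⟨u, v, hw⟩ := frame_surjective w
  refine hadm (List.ofFn (w ∘ midPos a k b)) ⟨List.ofFn u, List.ofFn v, ?_⟩ (by simp) ?_
  · rw [← ofFn_frame, ← hw]
  · rw [List.pairwise_ofFn]
    exact fun s t hst => h ⟨s, rfl⟩ ⟨t, rfl⟩ (midPos_strictMono hst)

/-- An inadmissible word is a concatenation with a strictly decreasing middle word of length `k`. -/
lemma exists_frame_of_not_isAdmissible {n : ℕ} {w : Fin n → Fin m}
    (h : ¬ IsAdmissible k (List.ofFn w)) :
    ∃ a b : ℕ, ∃ u : Fin a → Fin m, ∃ c : Fin k → Fin m, ∃ v : Fin b → Fin m,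
      StrictAnti c ∧ n = a + k + b ∧ List.ofFn w = List.ofFn (frame u c v) := by
  simp only [IsAdmissible, not_forall, not_not] at h
  obtain ⟨s, ⟨u, v, huv⟩, hs, hp⟩ := h
  obtain ⟨c, rfl⟩ := exists_ofFn_eq hs
  refine ⟨u.length, v.length, u.get, c, v.get, ?_, ?_, ?_⟩
  · rw [List.pairwise_ofFn] at hp
    exact fun s t hst => hp hst
  · have := congrArg List.length huv
    simp at this
    omega
  · rw [ofFn_frame, List.ofFn_get, List.ofFn_get, huv]

/-- The basis of words of the free algebra. -/
noncomputable abbrev wordBasis (m : ℕ) :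
    Module.Basis (FreeMonoid (Fin m)) ℂ (FreeAlgebra ℂ (Fin m)) :=
  FreeAlgebra.basisFreeMonoid ℂ (Fin m)

lemma wordBasis_ofList (l : List (Fin m)) :
    wordBasis m (FreeMonoid.ofList l) = (l.map (FreeAlgebra.ι ℂ)).prod := by
  simp [FreeAlgebra.basisFreeMonoid, FreeAlgebra.equivMonoidAlgebraFreeMonoid, FreeMonoid.lift_apply]

/-- The component of degree `n` of an element of the free algebra, as a tensor. -/
noncomputable def degreePart (m n : ℕ) :
    FreeAlgebra ℂ (Fin m) →ₗ[ℂ] ((Fin n → Fin m) → ℂ) :=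
  LinearMap.pi fun w => (wordBasis m).coord (FreeMonoid.ofList (List.ofFn w))

lemma degreePart_prod {n : ℕ} (l : List (Fin m)) (w : Fin n → Fin m) :
    degreePart m n (l.map (FreeAlgebra.ι ℂ)).prod w = if l = List.ofFn w then 1 else 0 := by
  classical
  rw [← wordBasis_ofList]
  simp [degreePart, Finsupp.single_apply]

/-- The tensors spanned by the run tensors of the inadmissible words of length `n`. They contain
the relations of `B_{m,k}` in degree `n`. -/
noncomputable def inadmissibleSpan (m k n : ℕ) : Submodule ℂ ((Fin n → Fin m) → ℂ) :=
  Submodule.span ℂ (runTensor '' {w | ¬ IsAdmissible k (List.ofFn w)})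

/-- A multiple of a relation by words is alternating on the window of the middle word. -/
lemma degreePart_relation_mem (n : ℕ) (u v : List (Fin m)) (i : Fin k → Fin m) :
    degreePart m n ((u.map (FreeAlgebra.ι ℂ)).prod *
      (∑ σ : Equiv.Perm (Fin k), ((Equiv.Perm.sign σ : ℤ) : ℂ) •
          (List.ofFn fun s : Fin k => FreeAlgebra.ι ℂ (i (σ s))).prod) *
      (v.map (FreeAlgebra.ι ℂ)).prod) ∈ inadmissibleSpan m k n := by
  classical
  have hexp : degreePart m n ((u.map (FreeAlgebra.ι ℂ)).prod *
      (∑ σ : Equiv.Perm (Fin k), ((Equiv.Perm.sign σ : ℤ) : ℂ) •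
          (List.ofFn fun s : Fin k => FreeAlgebra.ι ℂ (i (σ s))).prod) *
      (v.map (FreeAlgebra.ι ℂ)).prod) = fun w => ∑ σ : Equiv.Perm (Fin k),
        if List.ofFn (frame u.get (i ∘ σ) v.get) = List.ofFn w
          then ((Equiv.Perm.sign σ : ℤ) : ℂ) else 0 := by
    rw [Finset.mul_sum, Finset.sum_mul, map_sum]
    ext w
    rw [Finset.sum_apply]
    refine Finset.sum_congr rfl fun σ _ => ?_
    have : (List.ofFn fun s : Fin k => FreeAlgebra.ι ℂ (i (σ s))) =
      (List.ofFn (i ∘ σ)).map (FreeAlgebra.ι ℂ) := by rw [List.map_ofFn]; rfl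
    rw [this, mul_smul_comm, smul_mul_assoc, map_smul, ← List.prod_append, ← List.prod_append,
      ← List.map_append, ← List.map_append, Pi.smul_apply, degreePart_prod, ofFn_frame,
      List.ofFn_get, List.ofFn_get]
    simp
  rw [hexp]
  by_cases hn : n = u.length + k + v.length
  · subst hn
    have halt : IsAltOn (Set.range (midPos u.length k v.length))
        (fun w => ∑ σ : Equiv.Perm (Fin k),
        if List.ofFn (frame u.get (i ∘ σ) v.get) = List.ofFn w
          then ((Equiv.Perm.sign σ : ℤ) : ℂ) else 0) := by
      rintro _ ⟨p, rfl⟩ _ ⟨q, rfl⟩ hpq w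
      have hpq' : p ≠ q := fun h => hpq (h ▸ rfl)
      simp only [List.ofFn_inj, ← Finset.sum_neg_distrib]
      refine Finset.sum_bij' (fun σ _ => σ * Equiv.swap p q) (fun σ _ => σ * Equiv.swap p q)
        (by simp) (by simp) (by simp) (by simp) fun σ _ => ?_
      have h1 : frame u.get (i ∘ σ) v.get = w ∘ Equiv.swap (midPos u.length k v.length p)
          (midPos u.length k v.length q) ↔
          frame u.get (i ∘ ⇑(σ * Equiv.swap p q)) v.get = w := by
        have h2 := frame_comp_swap u.get (i ∘ σ) v.get p q
        rw [Equiv.Perm.coe_mul, ← Function.comp_assoc, ← h2]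
        constructor
        · intro h; rw [h]; ext x; simp
        · rintro rfl; ext x; simp
      simp only [h1, Equiv.Perm.sign_mul, Equiv.Perm.sign_swap hpq']
      split_ifs <;> simp
    refine Submodule.span_mono (Set.image_mono fun w hw => ?_)
      (halt.mem_span ordConnected_range_midPos)
    exact not_isAdmissible_of_strictAntiOn hw
  · refine (congrArg (· ∈ inadmissibleSpan m k n) (funext fun w => ?_)).mpr (zero_mem _)
    refine Finset.sum_eq_zero fun σ _ => if_neg fun h => hn ?_
    have := congrArg List.length h
    simpa using this.symm

lemma degreePart_mul_relation_mul_mem (n : ℕ) (x y : FreeAlgebra ℂ (Fin m)) (i : Fin k → Fin m) :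
    degreePart m n (x *
      (∑ σ : Equiv.Perm (Fin k), ((Equiv.Perm.sign σ : ℤ) : ℂ) •
          (List.ofFn fun s : Fin k => FreeAlgebra.ι ℂ (i (σ s))).prod) * y) ∈
      inadmissibleSpan m k n := by
  have hx : x ∈ Submodule.span ℂ (Set.range (wordBasis m)) := by
    rw [(wordBasis m).span_eq]; trivial
  have hy : y ∈ Submodule.span ℂ (Set.range (wordBasis m)) := by
    rw [(wordBasis m).span_eq]; trivial
  induction hx using Submodule.span_induction with
  | zero => simp
  | add x x' _ _ h h' => rw [add_mul, add_mul, map_add]; exact add_mem h h'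
  | smul c x _ h => rw [smul_mul_assoc, smul_mul_assoc, map_smul]; exact Submodule.smul_mem _ c h
  | mem x hx =>
    obtain ⟨u, rfl⟩ := hx
    induction hy using Submodule.span_induction with
    | zero => simp
    | add y y' _ _ h h' => rw [mul_add, map_add]; exact add_mem h h'
    | smul c y _ h => rw [mul_smul_comm, map_smul]; exact Submodule.smul_mem _ c h
    | mem y hy =>
      obtain ⟨v, rfl⟩ := hy
      have h := degreePart_relation_mem n u.toList v.toList i
      rwa [← wordBasis_ofList, ← wordBasis_ofList] at h

/-- Elements of the free algebra with the same image in `B_{m,k}` differ, in each degree, by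
a combination of run tensors of inadmissible words. -/
lemma degreePart_mem_of_eq {x y : FreeAlgebra ℂ (Fin m)}
    (h : RingQuot.mkAlgHom ℂ (AntisymRel m k) x = RingQuot.mkAlgHom ℂ (AntisymRel m k) y) (n : ℕ) :
    degreePart m n (x - y) ∈ inadmissibleSpan m k n := by
  have hE : Relation.EqvGen (RingQuot.Rel (AntisymRel m k)) x y := by
    have h' : RingQuot.mkRingHom (AntisymRel m k) x = RingQuot.mkRingHom (AntisymRel m k) y := by
      rw [← RingQuot.mkAlgHom_coe ℂ]; exact h
    simp only [RingQuot.mkRingHom_def] at h'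
    exact Quot.eqvGen_exact (congrArg RingQuot.toQuot h')
  -- With arbitrary factors on both sides, the induction over the generated congruence goes through.
  suffices H : ∀ p q, degreePart m n (p * (x - y) * q) ∈ inadmissibleSpan m k n by
    simpa using H 1 1
  clear h
  induction hE with
  | rel x y h =>
    induction h with
    | of h =>
      obtain ⟨i, hi⟩ := h
      intro p q
      rw [sub_zero]
      exact degreePart_mul_relation_mul_mem n p q i
    | add_left _ ih => simpa using ih
    | mul_left _ ih =>
      intro p q
      rw [← sub_mul, ← mul_assoc, mul_assoc _ _ q]
      exact ih _ _
    | mul_right _ ih =>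
      intro p q
      rw [← mul_sub, ← mul_assoc]
      exact ih _ _
  | refl x => simp
  | symm x y _ ih =>
    intro p q
    have := neg_mem (ih p q)
    rwa [← map_neg, ← neg_mul, ← mul_neg, neg_sub] at this
  | trans x y z _ _ ih1 ih2 =>
    intro p q
    have := add_mem (ih1 p q) (ih2 p q)
    rwa [← map_add, ← add_mul, ← mul_add, sub_add_sub_cancel] at this

lemma mkAlgHom_wordBasis (l : List (Fin m)) :
    RingQuot.mkAlgHom ℂ (AntisymRel m k) (wordBasis m (FreeMonoid.ofList l)) = monomialX l := by
  rw [wordBasis_ofList, map_list_prod, List.map_map]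
  rfl

lemma linearIndependent_monomialX :
    LinearIndependent ℂ fun i : AdmissibleSeq m k => (monomialX i.1 : AntisymAlgebra m k) := by
  classical
  rw [linearIndependent_iff]
  intro l hl
  set x : FreeAlgebra ℂ (Fin m) :=
    Finsupp.linearCombination ℂ (fun i : AdmissibleSeq m k => wordBasis m (FreeMonoid.ofList i.1)) l
    with hx
  have hx0 : RingQuot.mkAlgHom ℂ (AntisymRel m k) x = RingQuot.mkAlgHom ℂ (AntisymRel m k) 0 := by
    rw [map_zero, ← hl, hx, ← AlgHom.toLinearMap_apply, Finsupp.apply_linearCombination]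
    congr 2
    ext i
    exact mkAlgHom_wordBasis i.1
  have hcoef : ∀ (n : ℕ) (w : Fin n → Fin m), degreePart m n x w =
      l.sum fun i c => if i.1 = List.ofFn w then c else 0 := by
    intro n w
    rw [hx, Finsupp.linearCombination_apply, Finsupp.sum, map_sum, Finset.sum_apply, Finsupp.sum]
    refine Finset.sum_congr rfl fun i _ => ?_
    rw [map_smul, wordBasis_ofList, Pi.smul_apply, degreePart_prod]
    simp
  have hzero : ∀ n, degreePart m n x = 0 := by
    intro n
    have hmem := degreePart_mem_of_eq hx0 n
    rw [sub_zero] at hmem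
    refine eq_zero_of_mem_span_runTensor hmem fun w hw => ?_
    rw [hcoef]
    refine Finset.sum_eq_zero fun i _ => if_neg fun h => hw ?_
    rw [← h]; exact i.2
  ext i
  have h := congrFun (hzero i.1.length) i.1.get
  rw [hcoef, List.ofFn_get] at h
  simpa [Finsupp.sum, Subtype.ext_iff.symm] using h

/-- Every word reduces to admissible words with the same letters: a strictly decreasing window is
replaced by its permutations, which are lexicographically smaller. -/
lemma monomialX_mem_span {n : ℕ} (w : Fin n → Fin m) :
    (monomialX (List.ofFn w) : AntisymAlgebra m k) ∈
      Submodule.span ℂ ((fun i : AdmissibleSeq m k => (monomialX i.1 : AntisymAlgebra m k)) ''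
        {i | i.1.Perm (List.ofFn w)}) := by
  classical
  obtain ⟨v, hv⟩ : ∃ v, toLex w = v := ⟨_, rfl⟩
  induction v using WellFoundedLT.induction generalizing w with
  | ind v ih =>
    subst hv
    by_cases h : IsAdmissible k (List.ofFn w)
    · exact Submodule.subset_span ⟨⟨_, h⟩, List.Perm.refl _, rfl⟩
    · obtain ⟨a, b, u, c, v, hc, rfl, hw⟩ := exists_frame_of_not_isAdmissible h
      obtain rfl := List.ofFn_injective hw
      have hrel : ∑ σ : Equiv.Perm (Fin k), ((Equiv.Perm.sign σ : ℤ) : ℂ) •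
          (monomialX (List.ofFn (frame u (c ∘ σ) v)) : AntisymAlgebra m k) = 0 := by
        have h0 := antisymProd_apply (k := k) fun s => (Pi.single (c s) 1 : Fin m → ℂ)
        rw [antisymProd_eq_zero, AlternatingMap.zero_apply] at h0
        have h1 := congrArg (fun z => (monomialX (List.ofFn u) : AntisymAlgebra m k) * z *
          monomialX (List.ofFn v)) h0
        simp only [mul_zero, zero_mul, Finset.mul_sum, Finset.sum_mul, mul_smul_comm,
          smul_mul_assoc] at h1
        rw [h1]
        refine Finset.sum_congr rfl fun σ _ => ?_
        congr 1
        simp only [monomialX, ofFn_frame, List.map_append, List.prod_append, List.map_ofFn]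
        congr 3
        ext s
        simp [linGen_apply, Pi.single_apply]
      rw [← Finset.add_sum_erase _ _ (Finset.mem_univ 1)] at hrel
      simp only [Equiv.Perm.sign_one, Units.val_one, Int.cast_one, one_smul, Equiv.Perm.coe_one,
        Function.comp_id] at hrel
      rw [eq_neg_of_add_eq_zero_left hrel]
      refine neg_mem (sum_mem fun σ hσ => Submodule.smul_mem _ _ ?_)
      have hlt : toLex (c ∘ σ) < toLex c := toLex_comp_lt
        (mem_runPerms.2 fun i => hc.strictAntiOn _) (Finset.ne_of_mem_erase hσ)
      refine Submodule.span_mono (Set.image_mono fun i hi => List.Perm.trans hi ?_)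
        (ih _ (toLex_frame_lt u v hlt) _ rfl)
      rw [ofFn_frame, ofFn_frame]
      exact ((Equiv.Perm.ofFn_comp_perm σ c).append_left _).append_right _

lemma monomialX_mem_span_list (l : List (Fin m)) :
    (monomialX l : AntisymAlgebra m k) ∈
      Submodule.span ℂ ((fun i : AdmissibleSeq m k => (monomialX i.1 : AntisymAlgebra m k)) ''
        {i | i.1.Perm l}) := by
  simpa using monomialX_mem_span (k := k) l.get

lemma span_monomialX :
    ⊤ ≤ Submodule.span ℂ
      (Set.range fun i : AdmissibleSeq m k => (monomialX i.1 : AntisymAlgebra m k)) := by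
  intro z _
  obtain ⟨x, rfl⟩ := RingQuot.mkAlgHom_surjective ℂ (AntisymRel m k) z
  have hx : x ∈ Submodule.span ℂ (Set.range (wordBasis m)) := by
    rw [(wordBasis m).span_eq]; trivial
  induction hx using Submodule.span_induction with
  | zero => simp
  | add x x' _ _ h h' => rw [map_add]; exact add_mem (h trivial) (h' trivial)
  | smul c x _ h => rw [map_smul]; exact Submodule.smul_mem _ c (h trivial)
  | mem x hx =>
    obtain ⟨u, rfl⟩ := hx
    have := monomialX_mem_span_list (k := k) u.toList
    rw [← mkAlgHom_wordBasis] at this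
    exact Submodule.span_mono (Set.image_subset_range _ _) this

/-- The basis of admissible monomials. -/
noncomputable def admissibleBasis (m k : ℕ) :
    Module.Basis (AdmissibleSeq m k) ℂ (AntisymAlgebra m k) :=
  Module.Basis.mk linearIndependent_monomialX span_monomialX

lemma admissibleBasis_apply (i : AdmissibleSeq m k) : admissibleBasis m k i = monomialX i.1 := by
  simp [admissibleBasis]

/-- The basis expansion of a monomial only involves words with the same letters. -/
lemma perm_of_repr_ne_zero {l : List (Fin m)} {i : AdmissibleSeq m k}
    (h : (admissibleBasis m k).repr (monomialX l) i ≠ 0) : i.1.Perm l := by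
  have h1 := monomialX_mem_span_list (k := k) l
  have h2 : (fun i : AdmissibleSeq m k => (monomialX i.1 : AntisymAlgebra m k)) =
    admissibleBasis m k := by ext i; rw [admissibleBasis_apply]
  rw [h2, Module.Basis.mem_span_image] at h1
  exact h1 (Finsupp.mem_support_iff.2 h)

end Basis

/-! ### Traces of substitutions -/

section Trace

variable {m k : ℕ}

/-- The admissible words of length `n`. -/
abbrev AdmissibleWord (m k n : ℕ) : Type := {w : Fin n → Fin m // IsAdmissible k (List.ofFn w)}

noncomputable instance (m k n : ℕ) : Fintype (AdmissibleWord m k n) := Fintype.ofFinite _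

/-- An admissible word of length `n` as an admissible sequence. -/
def AdmissibleWord.toSeq {n : ℕ} (i : AdmissibleWord m k n) : AdmissibleSeq m k :=
  ⟨List.ofFn i.1, i.2⟩

lemma AdmissibleWord.toSeq_injective {n : ℕ} :
    Function.Injective (AdmissibleWord.toSeq : AdmissibleWord m k n → AdmissibleSeq m k) :=
  fun _ _ h => Subtype.ext (List.ofFn_injective (congrArg Subtype.val h))

/-- The matrix of the substitution `x_i ↦ y_i` on the component of degree `n` of `B_{m,k}`. -/
noncomputable def substMatrix (k n : ℕ) (A : Matrix (Fin m) (Fin m) ℂ) :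
    Matrix (AdmissibleWord m k n) (AdmissibleWord m k n) ℂ :=
  fun i j => (admissibleBasis m k).repr (monomialAX A i.toSeq.1) j.toSeq

lemma length_eq_of_repr_monomialAX_ne_zero {n : ℕ} {A : Matrix (Fin m) (Fin m) ℂ}
    {i : Fin n → Fin m} {J : AdmissibleSeq m k}
    (h : (admissibleBasis m k).repr (monomialAX A (List.ofFn i)) J ≠ 0) : J.1.length = n := by
  rw [monomialAX_ofFn, map_sum, Finsupp.finsetSum_apply] at h
  obtain ⟨w, -, hw⟩ := Finset.exists_ne_zero_of_sum_ne_zero h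
  rw [map_smul, Finsupp.smul_apply, smul_eq_mul] at hw
  simpa using (perm_of_repr_ne_zero (right_ne_zero_of_mul hw)).length_eq

lemma monomialAX_eq_sum {n : ℕ} (A : Matrix (Fin m) (Fin m) ℂ) (i : AdmissibleWord m k n) :
    (monomialAX A i.toSeq.1 : AntisymAlgebra m k) =
      ∑ j, substMatrix k n A i j • monomialX j.toSeq.1 := by
  classical
  apply (admissibleBasis m k).repr.injective
  ext J
  simp only [map_sum, map_smul, ← admissibleBasis_apply, Module.Basis.repr_self,
    Finsupp.finsetSum_apply, Finsupp.smul_apply, smul_eq_mul]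
  by_cases hJ : J.1.length = n
  · obtain ⟨f, hf⟩ := exists_ofFn_eq hJ
    obtain ⟨j, rfl⟩ : ∃ j : AdmissibleWord m k n, j.toSeq = J :=
      ⟨⟨f, hf ▸ J.2⟩, Subtype.ext hf⟩
    rw [Finset.sum_eq_single_of_mem j (Finset.mem_univ _)]
    · simp [substMatrix]
    · intro l _ hl
      rw [Finsupp.single_eq_of_ne fun h => hl (AdmissibleWord.toSeq_injective h.symm), mul_zero]
  · rw [Finset.sum_eq_zero fun l _ => ?_]
    · by_contra h
      exact hJ (length_eq_of_repr_monomialAX_ne_zero h)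
    · rw [Finsupp.single_eq_of_ne, mul_zero]
      rintro rfl
      exact hJ (by simp [AdmissibleWord.toSeq])

/-- Rows index the monomials that are substituted into, so the order of the factors is preserved
although `substHom` reverses it. -/
lemma substMatrix_mul {n : ℕ} (A B : Matrix (Fin m) (Fin m) ℂ) :
    substMatrix k n (A * B) = substMatrix k n A * substMatrix k n B := by
  ext i j
  rw [Matrix.mul_apply, substMatrix, ← substHom_monomialX, substHom_mul, AlgHom.comp_apply,
    substHom_monomialX, monomialAX_eq_sum A i]
  simp only [map_sum, map_smul, substHom_monomialX, Finsupp.finsetSum_apply, Finsupp.smul_apply,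
    smul_eq_mul]
  rfl

/-- The trace of the substitution by a triangular matrix only depends on its diagonal: a word
with smaller letters and the same content is the same word. -/
lemma trace_substMatrix_of_triangular {n : ℕ} {T : Matrix (Fin m) (Fin m) ℂ}
    (hT : ∀ i j, i < j → T i j = 0) :
    (substMatrix k n T).trace = ∑ i : AdmissibleWord m k n, ∏ s, T (i.1 s) (i.1 s) := by
  classical
  refine Finset.sum_congr rfl fun i _ => ?_
  rw [Matrix.diag_apply, substMatrix]
  change (admissibleBasis m k).repr (monomialAX T (List.ofFn i.1)) i.toSeq = _
  rw [monomialAX_ofFn, map_sum, Finsupp.finsetSum_apply,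
    Finset.sum_eq_single_of_mem i.1 (Finset.mem_univ _)]
  · have : (monomialX (List.ofFn i.1) : AntisymAlgebra m k) = admissibleBasis m k i.toSeq := by
      rw [admissibleBasis_apply]; rfl
    rw [map_smul, this, Module.Basis.repr_self]
    simp
  · intro w _ hw
    rw [map_smul, Finsupp.smul_apply, smul_eq_mul]
    by_contra h
    have h1 := (perm_of_repr_ne_zero (right_ne_zero_of_mul h)).map Fin.val
    have h2 : ∀ s, w s ≤ i.1 s := fun s => by
      by_contra hs
      exact left_ne_zero_of_mul h (Finset.prod_eq_zero (Finset.mem_univ s) (hT _ _ (not_le.1 hs)))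
    -- Letters can only decrease, and the sum of all letters is preserved.
    have h3 := h1.sum_eq
    simp only [AdmissibleWord.toSeq, List.map_ofFn, List.sum_ofFn, Function.comp_apply] at h3
    have h4 := (Finset.sum_eq_sum_iff_of_le fun s _ => Fin.le_def.1 (h2 s)).1 h3.symm
    exact hw (funext fun s => Fin.ext (h4 s (Finset.mem_univ _)))

end Trace

/-! ### Triangularization over the complex numbers -/

section Triangular

/-- Every endomorphism of a finite-dimensional complex vector space is triangular in some basis. -/
lemma exists_basis_triangular (n : ℕ) : ∀ (V : Type) [AddCommGroup V] [Module ℂ V]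
    [FiniteDimensional ℂ V] (_ : Module.finrank ℂ V = n) (f : V →ₗ[ℂ] V),
    ∃ b : Module.Basis (Fin n) ℂ V, ∀ i j, i < j → b.repr (f (b j)) i = 0 := by
  induction n with
  | zero =>
    intro V _ _ _ hV f
    exact ⟨Module.finBasisOfFinrankEq ℂ V hV, fun i => i.elim0⟩
  | succ n ih =>
    intro V _ _ _ hV f
    have : Nontrivial V := Module.nontrivial_of_finrank_eq_succ hV
    -- An eigenvector of the transpose is a functional whose kernel is an invariant hyperplane.
    obtain ⟨μ, hμ⟩ := Module.End.exists_eigenvalue (K := ℂ) (Module.Dual.transpose (R := ℂ) f)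
    obtain ⟨φ, hφ⟩ := hμ.exists_hasEigenvector
    have hφ0 : φ ≠ 0 := hφ.2
    have hφf : ∀ x, φ (f x) = μ * φ x := fun x =>
      LinearMap.congr_fun hφ.apply_eq_smul x
    have hW : Module.finrank ℂ (LinearMap.ker φ) = n := by
      have := Module.Dual.finrank_ker_add_one_of_ne_zero hφ0
      omega
    have hmaps : ∀ x ∈ LinearMap.ker φ, f x ∈ LinearMap.ker φ := fun x hx => by
      rw [LinearMap.mem_ker] at hx ⊢
      rw [hφf, hx, mul_zero]
    obtain ⟨b, hb⟩ := ih (LinearMap.ker φ) hW (f.restrict hmaps)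
    obtain ⟨y, hy⟩ : ∃ y, φ y ≠ 0 := by
      by_contra! h
      exact hφ0 (LinearMap.ext h)
    let B : Module.Basis (Fin (n + 1)) ℂ V := Module.Basis.mkFinCons y b
      (fun c x hx h => by
        have := congrArg φ h
        rw [map_add, map_smul, LinearMap.mem_ker.1 hx, map_zero, add_zero, smul_eq_mul] at this
        exact (mul_eq_zero.1 this).resolve_right hy)
      (fun z => ⟨-(φ z / φ y), by
        rw [LinearMap.mem_ker, map_add, map_smul, smul_eq_mul]
        field_simp
        ring⟩)
    have hB0 : B 0 = y := by simp [B]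
    have hBs : ∀ j, B j.succ = b j := fun j => by simp [B]
    have hrepr : ∀ z : LinearMap.ker φ, B.repr (z : V) = ∑ j, b.repr z j • B.repr (B j.succ) := by
      intro z
      have h := congrArg (LinearMap.ker φ).subtype (b.sum_repr z)
      simp only [map_sum, map_smul, Submodule.subtype_apply] at h
      rw [← h, map_sum]
      simp only [map_smul, hBs]
    refine ⟨B, fun i j hij => ?_⟩
    obtain ⟨j, rfl⟩ := Fin.exists_succ_eq.2 (Fin.ne_zero_of_lt hij)
    have hfB : f (B j.succ) = ((f.restrict hmaps (b j) : LinearMap.ker φ) : V) := by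
      rw [hBs]; rfl
    rw [hfB, hrepr]
    refine Fin.cases (fun _ => ?_) (fun i hij => ?_) i hij
    · simp [Finsupp.finsetSum_apply]
    · rw [Finsupp.finsetSum_apply, Finset.sum_eq_single_of_mem i (Finset.mem_univ _)]
      · rw [hb i j (Fin.succ_lt_succ_iff.1 hij)]; simp
      · intro l _ hl
        simp [hl]

/-- Every complex matrix is conjugate to a lower triangular one. -/
lemma exists_triangular_conj {m : ℕ} (A : Matrix (Fin m) (Fin m) ℂ) :
    ∃ P Q T : Matrix (Fin m) (Fin m) ℂ, Q * P = 1 ∧ A = P * (T * Q) ∧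
      ∀ i j, i < j → T i j = 0 := by
  obtain ⟨b, hb⟩ := exists_basis_triangular m (Fin m → ℂ) (by simp) (Matrix.toLin' A)
  refine ⟨(Pi.basisFun ℂ (Fin m)).toMatrix b, b.toMatrix (Pi.basisFun ℂ (Fin m)),
    LinearMap.toMatrix b b (Matrix.toLin' A), ?_, ?_, ?_⟩
  · rw [Module.Basis.toMatrix_mul_toMatrix, Module.Basis.toMatrix_self]
  · rw [← mul_assoc, basis_toMatrix_mul_linearMap_toMatrix_mul_basis_toMatrix]
    exact (LinearMap.toMatrix'_toLin' A).symm
  · intro i j hij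
    rw [LinearMap.toMatrix_apply]
    exact hb i j hij

end Triangular

/-! ### Factorizations of words -/

section Runs

variable {m k : ℕ}

/-- The list `w`, placed after `D`, does not start with a descent from the last letter of `D`; this
holds in particular if one of the two is empty. -/
def IsRunBreak (D w : List (Fin m)) : Prop :=
  ∀ D' a b w', D = D' ++ [a] → w = b :: w' → a ≤ b

lemma IsRunBreak.tail {a : Fin m} {D w : List (Fin m)} (h : IsRunBreak (a :: D) w) :
    IsRunBreak D w := fun D' x y w' hD hw => h (a :: D') x y w' (by simp [hD]) hw

lemma IsRunBreak.eq_nil {D w t : List (Fin m)} (h : IsRunBreak D w) (hD : D ≠ []) (ht : t <+: w)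
    (hp : (D ++ t).Pairwise (· > ·)) : t = [] := by
  cases t with
  | nil => rfl
  | cons b t =>
    obtain ⟨D', a, rfl⟩ := List.eq_nil_or_concat' D |>.resolve_left hD
    obtain ⟨r, hr⟩ := ht
    have h1 := h D' a b (t ++ r) rfl (by rw [← hr]; rfl)
    rw [List.pairwise_append] at hp
    exact absurd (hp.2.2 a (by simp) b (by simp)) (not_lt.2 h1)

/-- Every nonempty word starts with a maximal strictly decreasing run. -/
lemma exists_run (a : Fin m) (l : List (Fin m)) :
    ∃ D w, a :: l = a :: D ++ w ∧ (a :: D).Pairwise (· > ·) ∧ IsRunBreak (a :: D) w := by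
  induction l generalizing a with
  | nil => exact ⟨[], [], rfl, by simp, fun _ _ _ _ _ h => by simp at h⟩
  | cons b l ih =>
    rcases lt_or_ge b a with hab | hab
    · obtain ⟨D, w, h1, h2, h3⟩ := ih b
      refine ⟨b :: D, w, by rw [h1]; rfl, ?_, ?_⟩
      · rw [List.pairwise_cons]
        refine ⟨fun x hx => ?_, h2⟩
        rcases List.mem_cons.1 hx with rfl | hx
        · exact hab
        · exact lt_trans (List.rel_of_pairwise_cons h2 hx) hab
      · intro D' x y w' hD hw
        cases D' with
        | nil => simp at hD
        | cons c D' => exact h3 D' x y w' (by simpa using (List.cons.inj hD).2) hw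
    · refine ⟨[], b :: l, rfl, by simp, ?_⟩
      intro D' x y w' hD hw
      cases D' with
      | nil =>
        obtain ⟨rfl, -⟩ := List.cons.inj hw
        obtain ⟨rfl, -⟩ := List.cons.inj hD
        exact hab
      | cons c D' => simp at hD

/-- No strictly decreasing window crosses the end of a decreasing run. -/
lemma isAdmissible_append_iff {D w : List (Fin m)} (hD : D.Pairwise (· > ·)) (h : IsRunBreak D w) :
    IsAdmissible k (D ++ w) ↔ D.length < k ∧ IsAdmissible k w := by
  constructor
  · intro hadm
    refine ⟨not_le.1 fun hle => ?_, fun s hs => hadm s (hs.trans (List.suffix_append _ _).isInfix)⟩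
    exact hadm (D.take k) ((List.take_prefix _ _).trans (List.prefix_append _ _)).isInfix
      (by simpa using hle) (hD.sublist (List.take_sublist _ _))
  · rintro ⟨hlt, hw⟩
    induction D with
    | nil => exact hw
    | cons a D ih =>
      intro s hs hsk hp
      rw [List.cons_append, List.infix_cons_iff] at hs
      rcases hs with hs | hs
      · have hDs : a :: D <+: s := List.prefix_of_prefix_length_le (List.prefix_append (a :: D) w)
          hs (by omega)
        obtain ⟨t, rfl⟩ := hDs
        have ht : t = [] := h.eq_nil (by simp) ((List.prefix_append_right_inj (a :: D)).1 hs) hp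
        subst ht
        simp at hsk hlt
        omega
      · exact ih hD.of_cons h.tail (by simp at hlt; omega) s hs hsk hp

/-- The sign with which the `r`-th exterior power enters the alternating sum:
`1` for `r ≡ 0`, `-1` for `r ≡ 1`, and `0` otherwise, modulo `k`. -/
def koszulSign (k r : ℕ) : ℂ := (if r % k = 0 then 1 else 0) - (if r % k = 1 then 1 else 0)

lemma sum_range_koszulSign (hk : 2 ≤ k) (n : ℕ) :
    ∑ r ∈ range (n + 1), koszulSign k r = if k ∣ n then 1 else 0 := by
  induction n with
  | zero =>
    rw [Finset.sum_range_one, koszulSign]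
    simp
  | succ n ih =>
    have h1 : (n + 1) % k = 1 ↔ k ∣ n := by
      rw [Nat.dvd_iff_mod_eq_zero, Nat.add_mod, Nat.mod_eq_of_lt (a := 1) (by omega)]
      have := Nat.mod_lt n (show 0 < k by omega)
      rcases (show n % k + 1 < k ∨ n % k + 1 = k by omega) with h | h
      · rw [Nat.mod_eq_of_lt h]; omega
      · rw [h, Nat.mod_self]; omega
    rw [Finset.sum_range_succ, ih, koszulSign]
    simp only [h1, Nat.dvd_iff_mod_eq_zero]
    ring

lemma sum_range_koszulSign_window (hk : 2 ≤ k) {p : ℕ} (hp : 0 < p) :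
    ∑ r ∈ range (p + 1), (if p < r + k then koszulSign k r else 0) = 0 := by
  rw [← Finset.sum_filter]
  rcases lt_or_ge p k with h | h
  · rw [Finset.filter_true_of_mem fun r _ => by omega, sum_range_koszulSign hk,
      if_neg fun hd => absurd (Nat.le_of_dvd hp hd) (by omega)]
  · have h1 : (range (p + 1)).filter (fun r => p < r + k) = range (p + 1) \ range (p - k + 1) := by
      ext r; simp only [mem_filter, mem_range, mem_sdiff]; omega
    rw [h1, Finset.sum_sdiff_eq_sub (by intro r; simp only [mem_range]; omega),
      sum_range_koszulSign hk, sum_range_koszulSign hk]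
    have h2 : k ∣ p - k ↔ k ∣ p :=
      ⟨fun hd => by simpa [Nat.sub_add_cancel h] using Nat.dvd_add hd dvd_rfl,
        fun hd => Nat.dvd_sub hd dvd_rfl⟩
    simp only [h2, sub_self]

open Classical in
/-- The signed count of the factorizations of a word into a strictly decreasing and an admissible
word: the decreasing factor has to end within the last `k` positions of the first
decreasing run, and the signs cancel over these. -/
lemma sum_koszulSign_factorizations (hk : 2 ≤ k) (u : List (Fin m)) :
    ∑ j ∈ range (u.length + 1), koszulSign k j *
      (if (u.take j).Pairwise (· > ·) ∧ IsAdmissible k (u.drop j) then 1 else 0) =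
      if u = [] then 1 else 0 := by
  cases u with
  | nil =>
    have : IsAdmissible k ([] : List (Fin m)) := fun s hs hsk => by
      rw [List.infix_nil] at hs
      simp [hs] at hsk
      omega
    rw [List.length_nil, Finset.sum_range_one, koszulSign]
    simp [this]
  | cons a l =>
    obtain ⟨D, w, h1, h2, h3⟩ := exists_run a l
    rw [h1, if_neg (by simp)]
    set E := a :: D with hE
    have hE0 : 0 < E.length := by simp [hE]
    have key : ∀ j ∈ range ((E ++ w).length + 1),
        koszulSign k j * (if ((E ++ w).take j).Pairwise (· > ·) ∧
          IsAdmissible k ((E ++ w).drop j) then (1 : ℂ) else 0) =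
        if j < E.length + 1 then (if E.length < j + k then koszulSign k j else 0) *
          (if IsAdmissible k w then 1 else 0) else 0 := by
      intro j hj
      rw [mem_range, List.length_append] at hj
      by_cases hjE : j ≤ E.length
      · rw [if_pos (by omega : j < E.length + 1)]
        have ht : ((E ++ w).take j).Pairwise (· > ·) := by
          rw [List.take_append_of_le_length hjE]
          exact h2.sublist (List.take_sublist _ _)
        have hbreak : IsRunBreak (E.drop j) w := by
          intro D' x y w' hD hw
          refine h3 (E.take j ++ D') x y w' ?_ hw
          rw [List.append_assoc, ← hD, List.take_append_drop]
        rw [List.drop_append_of_le_length hjE,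
          isAdmissible_append_iff (h2.sublist (List.drop_sublist _ _)) hbreak,
          List.length_drop]
        have : E.length - j < k ↔ E.length < j + k := by omega
        simp only [ht, true_and, this]
        by_cases hw : IsAdmissible k w <;> by_cases hlt : E.length < j + k <;> simp [hw, hlt]
      · rw [if_neg (by omega : ¬ j < E.length + 1), if_neg, mul_zero]
        rintro ⟨hp, -⟩
        rw [List.take_append, List.take_of_length_le (by omega)] at hp
        have := congrArg List.length
          (h3.eq_nil (by simp [hE]) (List.take_prefix (j - E.length) w) hp)
        simp at this
        rcases this with h | h
        · omega
        · simp [h] at hj; omega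
    rw [Finset.sum_congr rfl key, ← Finset.sum_filter]
    have : (range ((E ++ w).length + 1)).filter (fun j => j < E.length + 1) =
        range (E.length + 1) := by
      ext j; simp only [mem_filter, mem_range, List.length_append]; omega
    rw [this, ← Finset.sum_mul, sum_range_koszulSign_window hk hE0, zero_mul]

end Runs

/-! ### The identity for diagonal matrices -/

section Diagonal

variable {m k : ℕ}

open Classical in
/-- Strictly decreasing words correspond to sets of letters, so that their monomials sum to an
elementary symmetric polynomial. -/
lemma sum_strictAnti_eq_esymm (x : Fin m → ℂ) (n : ℕ) :
    ∑ u : Fin n → Fin m, (if StrictAnti u then ∏ s, x (u s) else 0) =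
      ∑ t ∈ (univ : Finset (Fin m)).powersetCard n, ∏ i ∈ t, x i := by
  rw [← Finset.sum_filter]
  refine Finset.sum_bij' (i := fun u _ => univ.image u)
    (j := fun t ht => fun s => t.orderEmbOfFin (mem_powersetCard.1 ht).2 s.rev) ?_ ?_ ?_ ?_ ?_
  · intro u hu
    rw [mem_filter] at hu
    rw [mem_powersetCard, card_image_of_injective _ hu.2.injective]
    simp
  · intro t ht
    rw [mem_filter]
    exact ⟨mem_univ _, fun s s' h => (OrderEmbedding.strictMono _) (Fin.rev_lt_rev.2 h)⟩
  · intro u hu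
    rw [mem_filter] at hu
    have h := Finset.orderEmbOfFin_unique (s := univ.image u) (k := n)
      (by rw [card_image_of_injective _ hu.2.injective]; simp)
      (f := fun s => u s.rev) (fun s => by simp)
      (fun s s' h => hu.2 (Fin.rev_lt_rev.2 h))
    ext s
    rw [← congrFun h s.rev]
    simp
  · intro t ht
    ext i
    simp only [mem_image, mem_univ, true_and]
    constructor
    · rintro ⟨s, rfl⟩; exact Finset.orderEmbOfFin_mem _ _ _
    · intro hi
      have := Finset.range_orderEmbOfFin t (mem_powersetCard.1 ht).2
      obtain ⟨s, hs⟩ : i ∈ Set.range (t.orderEmbOfFin (mem_powersetCard.1 ht).2) := by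
        rw [this]; exact hi
      exact ⟨s.rev, by simpa using hs⟩
  · intro u hu
    rw [mem_filter] at hu
    rw [prod_image fun _ _ _ _ h => hu.2.injective h]

/-- The master identity for a diagonal matrix. -/
lemma sum_antidiagonal_esymm (hk : 2 ≤ k) (x : Fin m → ℂ) (n : ℕ) :
    ∑ pq ∈ antidiagonal n, koszulSign k pq.1 *
      (∑ t ∈ (univ : Finset (Fin m)).powersetCard pq.1, ∏ i ∈ t, x i) *
      (∑ i : AdmissibleWord m k pq.2, ∏ s, x (i.1 s)) = if n = 0 then 1 else 0 := by
  classical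
  have hterm : ∀ p q : ℕ, p + q = n →
      koszulSign k p * (∑ t ∈ (univ : Finset (Fin m)).powersetCard p, ∏ i ∈ t, x i) *
        (∑ i : AdmissibleWord m k q, ∏ s, x (i.1 s)) =
      ∑ u : Fin n → Fin m, (∏ s, x (u s)) * (koszulSign k p *
        (if ((List.ofFn u).take p).Pairwise (· > ·) ∧ IsAdmissible k ((List.ofFn u).drop p)
          then 1 else 0)) := by
    rintro p q rfl
    rw [← (Fin.appendEquiv p q).sum_comp, Fintype.sum_prod_type, ← sum_strictAnti_eq_esymm]
    have hadm : ∑ i : AdmissibleWord m k q, ∏ s, x (i.1 s) =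
        ∑ v : Fin q → Fin m, if IsAdmissible k (List.ofFn v) then ∏ s, x (v s) else 0 := by
      rw [← Finset.sum_filter]
      exact (Finset.sum_subtype _ (by simp) (fun v : Fin q → Fin m => ∏ s, x (v s))).symm
    rw [hadm, mul_assoc, Finset.sum_mul_sum, Finset.mul_sum]
    refine Finset.sum_congr rfl fun u _ => ?_
    rw [Finset.mul_sum]
    refine Finset.sum_congr rfl fun v _ => ?_
    have h1 : (Fin.appendEquiv p q) (u, v) = Fin.append u v := rfl
    have h2 : (List.ofFn u).Pairwise (· > ·) ↔ StrictAnti u := by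
      rw [List.pairwise_ofFn]; exact Iff.rfl
    rw [h1, List.ofFn_fin_append, List.take_left' (by simp), List.drop_left' (by simp),
      Fin.prod_univ_add]
    simp only [h2, Fin.append_left, Fin.append_right]
    by_cases hu : StrictAnti u <;> by_cases hv : IsAdmissible k (List.ofFn v) <;> simp [hu, hv]
    ring
  rw [Finset.sum_congr rfl fun pq h => hterm pq.1 pq.2 (mem_antidiagonal.1 h), Finset.sum_comm]
  have hword : ∀ u : Fin n → Fin m, ∑ pq ∈ antidiagonal n, (∏ s, x (u s)) * (koszulSign k pq.1 *
        (if ((List.ofFn u).take pq.1).Pairwise (· > ·) ∧ IsAdmissible k ((List.ofFn u).drop pq.1)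
          then 1 else 0)) = if n = 0 then 1 else 0 := by
    intro u
    rw [← Finset.mul_sum, Finset.Nat.sum_antidiagonal_eq_sum_range_succ_mk]
    have := sum_koszulSign_factorizations hk (List.ofFn u)
    rw [List.length_ofFn] at this
    rw [this]
    simp only [List.ofFn_eq_nil_iff]
    split_ifs with h
    · subst h; simp
    · simp
  rw [Finset.sum_congr rfl fun u _ => hword u]
  split_ifs with h
  · subst h; simp
  · simp

end Diagonal

/-! ### The identity for complex matrices -/

section Numeric

variable {m k : ℕ}

/-- The sum of the principal minors of size `r` of `A`, read off from the characteristic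
polynomial; the bound on `r` is needed as `m - r` is truncated. -/
noncomputable def minorSum {R : Type*} [CommRing R] (A : Matrix (Fin m) (Fin m) R) (r : ℕ) : R :=
  if r ≤ m then (-1) ^ r * A.charpoly.coeff (m - r) else 0

lemma minorSum_of_triangular {T : Matrix (Fin m) (Fin m) ℂ} (hT : ∀ i j, i < j → T i j = 0)
    (r : ℕ) : minorSum T r =
      ∑ t ∈ (univ : Finset (Fin m)).powersetCard r, ∏ i ∈ t, T i i := by
  rw [minorSum]
  split_ifs with hr
  · have h1 : T.charpoly = ((univ.val.map fun i => T i i).map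
        fun a => Polynomial.X - Polynomial.C a).prod := by
      rw [← Matrix.charpoly_transpose, Matrix.charpoly_of_isUpperTriangular]
      · rw [Multiset.map_map]; rfl
      · intro i j hij
        exact hT j i hij
    rw [h1, Multiset.prod_X_sub_C_coeff _ (by simp), Finset.esymm_map_val]
    simp only [Multiset.card_map, Finset.card_val, Finset.card_univ, Fintype.card_fin]
    rw [Nat.sub_sub_self hr, ← mul_assoc, ← mul_pow]
    simp
  · rw [Finset.powersetCard_eq_empty.2 (by simpa using hr), Finset.sum_empty]

/-- The alternating sum of traces vanishes in positive degree, by reduction to a triangular matrix,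
where it is the identity for its diagonal. -/
lemma sum_antidiagonal_trace (hk : 2 ≤ k) (A : Matrix (Fin m) (Fin m) ℂ) (n : ℕ) :
    ∑ pq ∈ antidiagonal n, koszulSign k pq.1 * minorSum A pq.1 * (substMatrix k pq.2 A).trace =
      if n = 0 then 1 else 0 := by
  obtain ⟨P, Q, T, hQP, rfl, hT⟩ := exists_triangular_conj A
  rw [← sum_antidiagonal_esymm hk (fun i => T i i) n]
  refine Finset.sum_congr rfl fun pq _ => ?_
  have h1 : minorSum (P * (T * Q)) pq.1 = minorSum T pq.1 := by
    rw [minorSum, minorSum, Matrix.charpoly_mul_comm, mul_assoc, hQP, mul_one]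
  have h2 : (substMatrix k pq.2 (P * (T * Q))).trace = (substMatrix k pq.2 T).trace := by
    rw [substMatrix_mul, Matrix.trace_mul_comm, ← substMatrix_mul, mul_assoc, hQP, mul_one]
  rw [h1, h2, minorSum_of_triangular hT, trace_substMatrix_of_triangular hT]

end Numeric

/-! ### Passage to formal power series -/

section Formal

variable {m k : ℕ}

/-- The component of degree `n` of the master series, the trace of `x_i ↦ t_i y_i`. -/
noncomputable def tracePoly (k n : ℕ) (A : Matrix (Fin m) (Fin m) ℂ) : MvPolynomial (Fin m) ℂ :=
  ∑ i : AdmissibleWord m k n,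
    MvPolynomial.C (coeffG (admissibleBasis m k) A i.toSeq) * ∏ s, MvPolynomial.X (i.1 s)

lemma monomialAX_diagonal_mul (t : Fin m → ℂ) (A : Matrix (Fin m) (Fin m) ℂ) (l : List (Fin m)) :
    (monomialAX (Matrix.diagonal t * A) l : AntisymAlgebra m k) =
      (l.map t).prod • monomialAX A l := by
  induction l with
  | nil => simp [monomialAX]
  | cons a l ih =>
    rw [monomialAX, List.map_cons, List.prod_cons, ← monomialAX, ih, List.map_cons, List.prod_cons,
      mul_smul, monomialAX, monomialAX, List.map_cons, List.prod_cons]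
    simp only [Matrix.diagonal_mul, mul_smul, ← Finset.smul_sum, smul_mul_assoc, mul_smul_comm]
    rw [smul_comm]

lemma eval_tracePoly (t : Fin m → ℂ) (n : ℕ) (A : Matrix (Fin m) (Fin m) ℂ) :
    MvPolynomial.eval t (tracePoly k n A) = (substMatrix k n (Matrix.diagonal t * A)).trace := by
  rw [tracePoly, map_sum, Matrix.trace]
  refine Finset.sum_congr rfl fun i _ => ?_
  rw [Matrix.diag_apply, substMatrix, monomialAX_diagonal_mul, map_smul, Finsupp.smul_apply,
    smul_eq_mul, mul_comm]
  simp [coeffG, AdmissibleWord.toSeq, List.map_ofFn, List.prod_ofFn]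

lemma eval_minorSum (t : Fin m → ℂ) (r : ℕ) (A : Matrix (Fin m) (Fin m) ℂ) :
    MvPolynomial.eval t (minorSum (matrixTA A) r) = minorSum (Matrix.diagonal t * A) r := by
  have h : (MvPolynomial.eval t).mapMatrix (matrixTA A) = Matrix.diagonal t * A := by
    ext i j
    simp [matrixTA, Matrix.diagonal_mul]
  rw [minorSum, minorSum]
  split_ifs
  · rw [← h, RingHom.mapMatrix_apply, Matrix.charpoly_map, Polynomial.coeff_map]
    simp
  · simp

lemma sum_antidiagonal_tracePoly (hk : 2 ≤ k) (A : Matrix (Fin m) (Fin m) ℂ) (n : ℕ) :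
    ∑ pq ∈ antidiagonal n, MvPolynomial.C (koszulSign k pq.1) * minorSum (matrixTA A) pq.1 *
      tracePoly k pq.2 A = if n = 0 then 1 else 0 := by
  refine MvPolynomial.funext fun t => ?_
  rw [map_sum]
  simp only [map_mul, MvPolynomial.eval_C, eval_minorSum, eval_tracePoly]
  rw [sum_antidiagonal_trace hk]
  split_ifs <;> simp

lemma isHomogeneous_tracePoly (n : ℕ) (A : Matrix (Fin m) (Fin m) ℂ) :
    (tracePoly k n A).IsHomogeneous n := by
  refine MvPolynomial.IsHomogeneous.sum _ _ _ fun i _ => ?_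
  have h := (MvPolynomial.isHomogeneous_C (Fin m)
    (coeffG (admissibleBasis m k) A i.toSeq)).mul
    (MvPolynomial.IsHomogeneous.prod univ (fun s => (MvPolynomial.X (i.1 s) : MvPolynomial _ ℂ))
      (fun _ => 1) fun s _ => MvPolynomial.isHomogeneous_X ℂ _)
  simpa using h

/-- The coefficients of the characteristic polynomial are homogeneous in the entries, and the entries
of `TA` are linear forms in the `t_i`. -/
lemma isHomogeneous_minorSum (r : ℕ) (A : Matrix (Fin m) (Fin m) ℂ) :
    (minorSum (matrixTA A) r).IsHomogeneous r := by
  rw [minorSum]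
  split_ifs with hr
  · have h1 := Matrix.charpoly.univ_coeff_isHomogeneous (n := Fin m) (R := ℂ) (m - r) r
      (by simp; omega)
    have h2 : MvPolynomial.eval₂ MvPolynomial.C (fun ij => matrixTA A ij.1 ij.2)
        ((Matrix.charpoly.univ ℂ (Fin m)).coeff (m - r)) = (matrixTA A).charpoly.coeff (m - r) :=
      Matrix.charpoly.univ_coeff_eval₂Hom (Fin m) MvPolynomial.C
        (fun ij => matrixTA A ij.1 ij.2) (m - r)
    have h3 := h1.eval₂ (n := 1) MvPolynomial.C (fun ij => matrixTA A ij.1 ij.2)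
      (fun _ => MvPolynomial.isHomogeneous_C _ _) fun ij => by
        rw [matrixTA, Matrix.diagonal_mul, Matrix.map_apply]
        exact (MvPolynomial.isHomogeneous_X ℂ ij.1).mul (MvPolynomial.isHomogeneous_C _ _)
    rw [h2, one_mul] at h3
    have h4 := (MvPolynomial.isHomogeneous_C (Fin m) ((-1 : ℂ) ^ r)).mul h3
    simpa using h4
  · exact MvPolynomial.isHomogeneous_zero _ _ _

lemma signedCharSum_eq (hk : 2 ≤ k) (A : Matrix (Fin m) (Fin m) ℂ) :
    signedCharSum k A =
      ∑ r ∈ range (m + 1), MvPolynomial.C (koszulSign k r) * minorSum (matrixTA A) r := by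
  rw [signedCharSum, Finset.sum_filter]
  refine Finset.sum_congr rfl fun r hr => ?_
  rw [minorSum, if_pos (Nat.lt_succ_iff.1 (mem_range.1 hr)), koszulSign, charCoeff]
  have h0 : r ≡ 0 [MOD k] ↔ r % k = 0 := by rw [Nat.ModEq, Nat.zero_mod]
  have h1 : r ≡ 1 [MOD k] ↔ r % k = 1 := by rw [Nat.ModEq, Nat.mod_eq_of_lt (a := 1) (by omega)]
  simp only [h0, h1]
  by_cases h : r % k = 0
  · simp [h]
  · by_cases h' : r % k = 1
    · have hr1 : 1 ≤ r := by
        by_contra hlt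
        obtain rfl : r = 0 := by omega
        simp at h
      obtain ⟨s, rfl⟩ : ∃ s, r = s + 1 := ⟨r - 1, by omega⟩
      simp [h', pow_succ]
    · simp [h, h']

lemma coeff_signedCharSum (hk : 2 ≤ k) (A : Matrix (Fin m) (Fin m) ℂ) (d : Fin m →₀ ℕ) :
    (signedCharSum k A).coeff d =
      koszulSign k d.degree * (minorSum (matrixTA A) d.degree).coeff d := by
  rw [signedCharSum_eq hk, MvPolynomial.coeff_sum]
  simp only [MvPolynomial.coeff_C_mul]
  rw [Finset.sum_eq_single d.degree]
  · intro r _ hr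
    rw [(isHomogeneous_minorSum r A).coeff_eq_zero fun h => hr h.symm, mul_zero]
  · intro hd
    rw [mem_range, Nat.lt_succ_iff] at hd
    rw [minorSum, if_neg hd, MvPolynomial.coeff_zero, mul_zero]

lemma prod_X_eq_monomial (l : List (Fin m)) :
    (l.map (MvPolynomial.X : Fin m → MvPolynomial (Fin m) ℂ)).prod =
      MvPolynomial.monomial (Multiset.toFinsupp (l : Multiset (Fin m))) 1 := by
  induction l with
  | nil => simp
  | cons a l ih =>
    rw [List.map_cons, List.prod_cons, ih, MvPolynomial.X, MvPolynomial.monomial_mul, one_mul,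
      ← Multiset.cons_coe, ← Multiset.singleton_add, map_add, Multiset.toFinsupp_singleton]

lemma coeff_masterSeries (A : Matrix (Fin m) (Fin m) ℂ) (d : Fin m →₀ ℕ) :
    MvPowerSeries.coeff d (masterSeries (admissibleBasis m k) A) =
      (tracePoly k d.degree A).coeff d := by
  classical
  rw [MvPowerSeries.coeff_apply, masterSeries, tracePoly, MvPolynomial.coeff_sum]
  have h1 : ∀ i : AdmissibleWord m k d.degree, MvPolynomial.coeff d
      (MvPolynomial.C (coeffG (admissibleBasis m k) A i.toSeq) * ∏ s, MvPolynomial.X (i.1 s)) =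
      if (i.toSeq.1 : Multiset (Fin m)) = Finsupp.toMultiset d
        then coeffG (admissibleBasis m k) A i.toSeq else 0 := by
    intro i
    have h2 : (∏ s, MvPolynomial.X (i.1 s) : MvPolynomial (Fin m) ℂ) =
        (i.toSeq.1.map MvPolynomial.X).prod := by
      simp [AdmissibleWord.toSeq, List.map_ofFn, List.prod_ofFn]
    rw [h2, prod_X_eq_monomial, MvPolynomial.coeff_C_mul, MvPolynomial.coeff_monomial, mul_ite,
      mul_one, mul_zero]
    congr 1
    exact propext ⟨fun h => (Multiset.toFinsupp_toMultiset _).symm.trans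
      (congrArg Finsupp.toMultiset h),
      fun h => by rw [h, Finsupp.toMultiset_toFinsupp]⟩
  rw [Finset.sum_congr rfl fun i _ => h1 i, ← Finset.sum_filter]
  symm
  refine Finset.sum_bij (fun i _ => i.toSeq) ?_ ?_ ?_ ?_
  · intro i hi
    rw [mem_filter] at hi
    rw [Finset.mem_subtype, Multiset.mem_toFinset, Multiset.mem_lists_iff]
    exact hi.2.symm
  · exact fun i _ j _ h => AdmissibleWord.toSeq_injective h
  · intro J hJ
    rw [Finset.mem_subtype, Multiset.mem_toFinset, Multiset.mem_lists_iff] at hJ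
    have hlen : J.1.length = d.degree := by
      have := congrArg Multiset.card hJ
      rw [Finsupp.card_toMultiset] at this
      exact this.symm
    obtain ⟨f, hf⟩ := exists_ofFn_eq hlen
    refine ⟨⟨f, hf ▸ J.2⟩, ?_, Subtype.ext hf⟩
    rw [mem_filter]
    exact ⟨mem_univ _, by rw [hJ]; exact congrArg _ hf⟩
  · intro i _; rfl

/-- By homogeneity, the coefficient of `t^d` in the product only involves the summands of
`sum_antidiagonal_tracePoly` in degree `|d|`. -/
lemma masterSeries_mul_signedCharSum (hk : 2 ≤ k) (A : Matrix (Fin m) (Fin m) ℂ) :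
    masterSeries (admissibleBasis m k) A *
      ((signedCharSum k A : MvPolynomial (Fin m) ℂ) : MvPowerSeries (Fin m) ℂ) = 1 := by
  classical
  ext d
  have h := congrArg (MvPolynomial.coeff d) (sum_antidiagonal_tracePoly hk A d.degree)
  rw [MvPolynomial.coeff_sum] at h
  simp only [mul_assoc, MvPolynomial.coeff_C_mul] at h
  simp only [MvPolynomial.coeff_mul, Finset.mul_sum] at h
  rw [Finset.sum_comm] at h
  rw [mul_comm, MvPowerSeries.coeff_mul, MvPowerSeries.coeff_one]
  simp only [MvPolynomial.coeff_coe, coeff_masterSeries, coeff_signedCharSum hk]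
  have hd : d.degree = 0 ↔ d = 0 := Finsupp.degree_eq_zero_iff d
  have hR : MvPolynomial.coeff d (if d.degree = 0 then (1 : MvPolynomial (Fin m) ℂ) else 0) =
      if d = 0 then 1 else 0 := by
    simp only [hd]
    split_ifs with h0
    · simp [h0]
    · simp
  rw [← hR, ← h]
  refine Finset.sum_congr rfl fun ab hab => ?_
  rw [HasAntidiagonal.mem_antidiagonal] at hab
  rw [Finset.sum_eq_single (ab.1.degree, ab.2.degree)]
  · ring
  · intro pq _ hpq
    by_cases h1 : ab.1.degree = pq.1
    · by_cases h2 : ab.2.degree = pq.2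
      · exact absurd (by rw [h1, h2]) hpq
      · rw [(isHomogeneous_tracePoly pq.2 A).coeff_eq_zero h2, mul_zero, mul_zero]
    · rw [(isHomogeneous_minorSum pq.1 A).coeff_eq_zero h1, zero_mul, mul_zero]
  · intro hmem
    refine absurd (HasAntidiagonal.mem_antidiagonal.2 ?_) hmem
    rw [← hab, map_add]

end Formal

/-! ### The case of commuting variables -/

section MacMahon

variable {m : ℕ}

/-- The homomorphism from `B_{m,2}` to the polynomial ring that sends the generators to the
variables. -/
noncomputable def toPolynomial (m : ℕ) : AntisymAlgebra m 2 →ₐ[ℂ] MvPolynomial (Fin m) ℂ :=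
  RingQuot.liftAlgHom ℂ ⟨FreeAlgebra.lift ℂ MvPolynomial.X, by
    rintro _ _ ⟨i, hi⟩
    have h0 : ∑ σ : Equiv.Perm (Fin 2), ((Equiv.Perm.sign σ : ℤ) : ℂ) = 0 := by
      rw [← Int.cast_sum, (by decide : ∑ σ : Equiv.Perm (Fin 2), (Equiv.Perm.sign σ : ℤ) = 0),
        Int.cast_zero]
    rw [map_zero, map_sum, ← zero_smul ℂ (∏ s, (MvPolynomial.X (i s) : MvPolynomial (Fin m) ℂ)),
      ← h0, Finset.sum_smul]
    refine Finset.sum_congr rfl fun σ _ => ?_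
    rw [map_smul, map_list_prod, List.map_ofFn, List.prod_ofFn,
      ← Equiv.prod_comp σ fun s => (MvPolynomial.X (i s) : MvPolynomial (Fin m) ℂ)]
    simp⟩

lemma toPolynomial_gen (j : Fin m) : toPolynomial m (gen m 2 j) = MvPolynomial.X j := by
  simp [toPolynomial, gen]

lemma toPolynomial_monomialX (l : List (Fin m)) : toPolynomial m (monomialX l) =
    MvPolynomial.monomial (Multiset.toFinsupp (l : Multiset (Fin m))) 1 := by
  rw [monomialX, map_list_prod, List.map_map, ← prod_X_eq_monomial]
  congr 2
  ext1 j
  exact toPolynomial_gen j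

/-- For `k = 2` the admissible words are the weakly increasing ones. -/
lemma pairwise_le_of_isAdmissible {l : List (Fin m)} (h : IsAdmissible 2 l) :
    l.Pairwise (· ≤ ·) := by
  rw [← List.isChain_iff_pairwise, List.isChain_iff_forall_rel_of_append_cons_cons]
  intro a b u v hl
  by_contra hab
  exact h [a, b] ⟨u, v, by simp [hl]⟩ rfl (by simpa using hab)

lemma isAdmissible_of_pairwise_le {l : List (Fin m)} (h : l.Pairwise (· ≤ ·)) :
    IsAdmissible 2 l := by
  intro s hs hsk hp
  obtain ⟨a, b, rfl⟩ := List.length_eq_two.1 hsk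
  have h1 := h.sublist hs.sublist
  simp at h1 hp
  exact absurd hp (not_lt.2 h1)

lemma masterSeries_eq_macMahonSeries (A : Matrix (Fin m) (Fin m) ℂ) :
    masterSeries (admissibleBasis m 2) A = macMahonSeries A := by
  classical
  funext d
  set L : List (Fin m) := (Finsupp.toMultiset d).sort (· ≤ ·) with hL
  have hLd : (L : Multiset (Fin m)) = Finsupp.toMultiset d := Multiset.sort_eq _ _
  have hadm : IsAdmissible 2 L := isAdmissible_of_pairwise_le (Multiset.pairwise_sort _ _)
  have huniq : ∀ J : AdmissibleSeq m 2, (J.1 : Multiset (Fin m)) = Finsupp.toMultiset d →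
      J = ⟨L, hadm⟩ := fun J hJ => Subtype.ext <| List.Perm.eq_of_pairwise
    (fun _ _ _ _ h1 h2 => le_antisymm h1 h2) (pairwise_le_of_isAdmissible J.2)
    (Multiset.pairwise_sort _ _) (Multiset.coe_eq_coe.1 (hJ.trans hLd.symm))
  have hleft : masterSeries (admissibleBasis m 2) A d =
      coeffG (admissibleBasis m 2) A ⟨L, hadm⟩ := by
    rw [masterSeries, Finset.sum_eq_single_of_mem (⟨L, hadm⟩ : AdmissibleSeq m 2)]
    · rw [Finset.mem_subtype, Multiset.mem_toFinset, Multiset.mem_lists_iff]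
      exact hLd.symm
    · intro J hJ hne
      rw [Finset.mem_subtype, Multiset.mem_toFinset, Multiset.mem_lists_iff] at hJ
      exact absurd (huniq J hJ.symm) hne
  have hprod : toPolynomial m (monomialAX A L) =
      ∏ i, (∑ j, MvPolynomial.C (A i j) * MvPolynomial.X j : MvPolynomial (Fin m) ℂ) ^ d i := by
    rw [monomialAX, map_list_prod, List.map_map, ← Multiset.prod_coe, ← Multiset.map_coe, hLd,
      Finsupp.toMultiset_map, Finsupp.prod_toMultiset, Finsupp.prod_mapDomain_index
        (fun _ => pow_zero _) (fun _ _ _ => pow_add _ _ _),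
      Finsupp.prod_fintype _ _ fun _ => pow_zero _]
    simp [toPolynomial_gen, MvPolynomial.smul_eq_C_mul]
  have hrepr : toPolynomial m (monomialAX A L) =
      ((admissibleBasis m 2).repr (monomialAX A L)).sum fun J c =>
        MvPolynomial.monomial (Multiset.toFinsupp (J.1 : Multiset (Fin m))) c := by
    conv_lhs => rw [← (admissibleBasis m 2).linearCombination_repr (monomialAX A L)]
    rw [Finsupp.linearCombination_apply, map_finsuppSum]
    refine Finsupp.sum_congr fun J _ => ?_
    rw [map_smul, admissibleBasis_apply, toPolynomial_monomialX, MvPolynomial.smul_monomial]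
    simp
  rw [hleft, macMahonSeries, ← hprod, hrepr, Finsupp.sum, MvPolynomial.coeff_sum, coeffG]
  simp only [MvPolynomial.coeff_monomial]
  have hiff : ∀ J : AdmissibleSeq m 2,
      Multiset.toFinsupp (J.1 : Multiset (Fin m)) = d ↔ J = ⟨L, hadm⟩ := fun J => by
    constructor
    · rintro h
      exact huniq J (by rw [← h, Multiset.toFinsupp_toMultiset])
    · rintro rfl
      rw [hLd, Finsupp.toMultiset_toFinsupp]
  simp only [hiff]
  simp

lemma signedCharSum_two (A : Matrix (Fin m) (Fin m) ℂ) :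
    signedCharSum 2 A = (1 - matrixTA A).det := by
  have h := Matrix.eval_charpoly (matrixTA A) 1
  rw [map_one] at h
  rw [← h, Polynomial.eval_eq_sum_range, Matrix.charpoly_natDegree_eq_dim, Fintype.card_fin,
    ← Finset.sum_range_reflect, signedCharSum, Finset.filter_true_of_mem]
  · refine Finset.sum_congr rfl fun r _ => ?_
    have : Even (r - r % 2) := by rw [Nat.even_iff]; omega
    rw [this.neg_one_pow, charCoeff]
    simp
  · intro r _
    simp only [Nat.ModEq]
    omega

end MacMahon

end MasterKoszul

theorem theorem2 (m k : ℕ) (hk : 2 ≤ k) (hkm : k ≤ m) :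
    ∃ b : Module.Basis (MasterKoszul.AdmissibleSeq m k) ℂ (MasterKoszul.AntisymAlgebra m k),
      (∀ i : MasterKoszul.AdmissibleSeq m k, b i = MasterKoszul.monomialX i.1) ∧
      ∀ A : Matrix (Fin m) (Fin m) ℂ,
        MasterKoszul.masterSeries b A *
            ((MasterKoszul.signedCharSum k A : MvPolynomial (Fin m) ℂ) :
              MvPowerSeries (Fin m) ℂ) = 1 ∧
        (k = 2 →
          MasterKoszul.masterSeries b A = MasterKoszul.macMahonSeries A ∧
          MasterKoszul.signedCharSum k A = (1 - MasterKoszul.matrixTA A).det) := by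
  refine ⟨MasterKoszul.admissibleBasis m k, MasterKoszul.admissibleBasis_apply, fun A =>
    ⟨MasterKoszul.masterSeries_mul_signedCharSum hk A, ?_⟩⟩
  rintro rfl
  exact ⟨MasterKoszul.masterSeries_eq_macMahonSeries A, MasterKoszul.signedCharSum_two A⟩
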